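/- **Setting.** Let $X\in\mathbb{R}^{n\times p}$ be a fixed matrix with columns $X_1,\dots,X_p$ normalized so that $\|X_j\|_2^2/n=1$ for all $j$; let $y=X\beta^*+w$, where the entries of $w$ are i.i.d. $\mathcal N(0,\sigma^2)$ with $\sigma>0$, and $\beta^*\in\mathbb{R}^p$ has support $S^*=\{j:\beta^*_j\neq 0\}$ with $|S^*|=k$, $k\ge 1$, $2k\le p$. Put $$\beta_{\min}=\min_{j\in S^*}|\beta^*_j|,\qquad \rho_{2k}=\min\Big\{\frac{\|X_Av\|_2^2}{n\|v\|_2^2}: S^*\subseteq A\subseteq\{1,\dots,p\},\ |A|=2k,\ 0\ne v\in\mathbb{R}^{2k}\Big\},$$ where $X_A$ is the submatrix of the columns indexed by $A$, and assume $\rho_{2k}>0$. For $S\subseteq\{1,\dots,p\}$ let $\Pi^\perp[S]$ be the orthogonal projection of $\mathbb{R}^n$ onto the orthogonal complement of the span of $\{X_j:j\in S\}$. Let $\mathsf{Alg}$ be any map that assigns to $y$, $X$ and a sparsity level $s\in\{0,1,\dots,\min\{n,p\}\}$ a set $\widehat S_s=\mathsf{Alg}(y,X,s)\subseteq\{1,\dots,p\}$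 with $|\widehat S_s|=s$. The algorithm $\mathsf{PaTh}$ with parameter $c$ goes through $s=0,1,\dots,\min\{n,p\}$ and returns $\widehat S=\widehat S_s$ for the first $s$ with $$\max_{j\notin\widehat S_s}\Big\{\|\Pi^\perp[\widehat S_s]y\|_2^2-\|\Pi^\perp[\widehat S_s\cup\{j\}]y\|_2^2\Big\}<2c\,\widehat\sigma_s^2\log p,\qquad \widehat\sigma_s^2=\|\Pi^\perp[\widehat S_s]y\|_2^2/n$$ (a maximum over the empty set is read as $0$; if no $s$ qualifies, nothing is returned). **Theorem.** For every $\epsilon<1$ and every $c>1/(1-\epsilon)$ there is a constant $C>0$, depending only on $\epsilon$ and $c$, such that the following holds for all $n,p,k,X,\beta^*,\sigma$ and $\mathsf{Alg}$ as above. If $\mathbb P(\mathsf{Alg}(y,X,k)=S^*)\ge 1-1/p^{c}$, $\ \epsilon>k/n+\sqrt{1/k}$, and $$n\ \ge\ \frac{2ck\log p}{\rho_{2k}}+\frac{8\sigma c\sqrt{k}\,\log p}{\beta_{\min}\rho_{2k}^2}+\frac{8\sigma^2c\log p}{\beta_{\min}^2\rho_{2k}^2},$$ then the output $\widehat S$ of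 $\mathsf{PaTh}$ with parameter $c$ satisfies $$\mathbb P(\widehat S=S^*)\ \ge\ 1-C\,p^{\,1-(1-\epsilon)c}.$$ -/

import Mathlib

open MeasureTheory ProbabilityTheory
open scoped NNReal

namespace SparseRegression

/-- The `j`-th column `X_j ∈ ℝⁿ` of the measurement matrix, as a Euclidean vector. -/
noncomputable def column {n p : ℕ} (X : Matrix (Fin n) (Fin p) ℝ) (j : Fin p) :
    EuclideanSpace ℝ (Fin n) :=
  WithLp.toLp 2 (fun i => X i j)

/-- The matrix-vector product `X_A v = ∑_{j ∈ A} v_j X_j`, with `v` indexed by `A`. -/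
noncomputable def mulColumns {n p : ℕ} (X : Matrix (Fin n) (Fin p) ℝ) (A : Finset (Fin p))
    (v : EuclideanSpace ℝ A) : EuclideanSpace ℝ (Fin n) :=
  ∑ j : A, v j • column X j

/-- The noisy observations `y = X β + w` of the linear model. -/
noncomputable def observe {n p : ℕ} (X : Matrix (Fin n) (Fin p) ℝ) (β : Fin p → ℝ)
    (w : Fin n → ℝ) : EuclideanSpace ℝ (Fin n) :=
  WithLp.toLp 2 (X.mulVec β + w)

/-- The support `{j : β_j ≠ 0}`. -/
noncomputable def supp {p : ℕ} (β : Fin p → ℝ) : Finset (Fin p) :=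
  Finset.univ.filter (fun j => β j ≠ 0)

/-- The smallest absolute value of a non-zero entry of `β`. -/
noncomputable def betaMin {p : ℕ} (β : Fin p → ℝ) : ℝ :=
  sInf ((fun j => |β j|) '' (supp β : Set (Fin p)))

/-- The restricted eigenvalue `ρ_m`: the minimum of `‖X_A v‖² / (n ‖v‖²)` over the sets `A ⊇ S` of
`m` columns and the non-zero vectors `v` indexed by `A`. -/
noncomputable def restrictedEigenvalue {n p : ℕ} (X : Matrix (Fin n) (Fin p) ℝ)
    (S : Finset (Fin p)) (m : ℕ) : ℝ :=
  sInf {t : ℝ | ∃ A : Finset (Fin p), S ⊆ A ∧ A.card = m ∧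
    ∃ v : EuclideanSpace ℝ A, v ≠ 0 ∧ t = ‖mulColumns X A v‖ ^ 2 / (n * ‖v‖ ^ 2)}

/-- The residual `Π^⊥[S] y`: the orthogonal projection of `y` onto the orthogonal complement of
the span of the columns indexed by `S`. -/
noncomputable def residual {n p : ℕ} (X : Matrix (Fin n) (Fin p) ℝ) (S : Finset (Fin p))
    (y : EuclideanSpace ℝ (Fin n)) : EuclideanSpace ℝ (Fin n) :=
  (Submodule.span ℝ (column X '' (S : Set (Fin p))))ᗮ.starProjection y

/-- The least-squares loss `‖Π^⊥[S] y‖²`. -/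
noncomputable def loss {n p : ℕ} (X : Matrix (Fin n) (Fin p) ℝ) (y : EuclideanSpace ℝ (Fin n))
    (S : Finset (Fin p)) : ℝ :=
  ‖residual X S y‖ ^ 2

/-- The variance estimate `‖Π^⊥[S] y‖² / n`. -/
noncomputable def sigmaHatSq {n p : ℕ} (X : Matrix (Fin n) (Fin p) ℝ)
    (y : EuclideanSpace ℝ (Fin n)) (S : Finset (Fin p)) : ℝ :=
  loss X y S / n

/-- The largest possible decrease of the loss when one variable outside `S` is added to `S`
(with the value `0` if there is no variable outside `S`). -/
noncomputable def maxDecrease {n p : ℕ} (X : Matrix (Fin n) (Fin p) ℝ)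
    (y : EuclideanSpace ℝ (Fin n)) (S : Finset (Fin p)) : ℝ :=
  ⨆ j : {j : Fin p // j ∉ S}, (loss X y S - loss X y (insert j.1 S))

/-- A sparse regression algorithm: from the data `y`, `X` and a desired sparsity level `s` it
computes a support estimate with exactly `s` elements (for every level that is ever used). -/
structure Algorithm (n p : ℕ) where
  /-- The support estimate at sparsity level `s`. -/
  run : EuclideanSpace ℝ (Fin n) → Matrix (Fin n) (Fin p) ℝ → ℕ → Finset (Fin p)
  /-- The estimate at sparsity level `s` has `s` elements. -/
  card_run : ∀ y X s, s ≤ min n p → (run y X s).card = s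

open Classical in
/-- Path thresholding with parameter `c`: run through `s = 0, 1, …, min n p` and return
the estimate at the first `s` at which the largest possible decrease of the loss is below
`2 c σ̂_s² log p`; the value is `none` if this never happens. -/
noncomputable def path {n p : ℕ} (alg : Algorithm n p) (y : EuclideanSpace ℝ (Fin n))
    (X : Matrix (Fin n) (Fin p) ℝ) (c : ℝ) : Option (Finset (Fin p)) :=
  ((List.range (min n p + 1)).find? (fun s =>
    decide (maxDecrease X y (alg.run y X s)
      < 2 * c * sigmaHatSq X y (alg.run y X s) * Real.log p))).map (fun s => alg.run y X s)

end SparseRegression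

/-!
# Path thresholding recovers the support

Write `y = ∑_{i ∈ S₀} β_i X_i + w` with `S₀` the support, `k = |S₀|`, `L = c log p`, `N = n ρ`,
where `ρ` is the restricted eigenvalue, `b` for the smallest non-zero `|β_i|`, and let a set `S`
with `|S| < k` be proposed at some level. The algorithm is arbitrary and sees the noise, so `S` may
be any set; a union bound over all pairs of missed variables `T = S₀ \ S`, `|T| = t`, and wrong
variables `F = S \ S₀`, `|F| < t`, would involve about `p^(2t)` events, while the tail
probabilities are only about `p^(-ct)` with `c` close to `1`. The proof therefore first shows that
few of these pairs matter.

*Normal equations.* Let `d_j`, `j ∈ S₀ ∪ F`, be the dual vectors of the columns (`dualVec`): least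
squares on `S₀ ∪ F` estimates `β_j` by `⟪d_j, y⟫ = β_j + ⟪d_j, w⟫`. With `ξ_i = ⟪X_i, r⟫`, `r` the
residual of `y` on `S`, one has `β_j + ⟪d_j, w⟫ = ∑_{i ∈ T} ⟪d_i, d_j⟫ ξ_i` for `j ∈ T`
(`add_inner_dualVec_eq_sum`). Adding the variable `i` decreases the loss by at least `ξ_i² / n`, so
if the search stopped at `S` then all `|ξ_i|` would be at most `Ξ = √(2 L · loss)`, and the sample
size is such that `Ξ / N ≤ b / 2` (`sqrt_two_mul_loss_div_le`).

*Sign sums.* Multiplying the equations by the signs of the `β_j` and adding them, the noise has to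
account for `t (b - Ξ / N) ≥ t b / 2` (`card_mul_le_abs_inner_signedDual`), whereas the signed sum
of the `d_j` has squared norm at most `t / N`. This has probability about `p^(-ct)` for each pair
`(T, F)`.

*Counting.* Fix `F`. For all but `O(t²)` elements `j` of `S₀` the vector `d_j` is so close to the
dual vector of `X_j` for `S₀` itself that `⟪d_j, w⟫` obeys the bound for one of `p` Gaussians
instead of the bound for a sign sum (`abs_inner_dualVec_le`). If many elements of `T` are of this
kind and are not coupled to the other elements of `T`, then their equations cannot hold
(`card_sdiff_mul_le`). Hence a bounded number of rounds, each of which adds to a set `W ⊆ T` some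
of the `O(t²)` elements of `S₀` that are affected by `F` or coupled to `W` (`eligible`, `grow`),
exhausts all but `(ε / 2) t` elements of `T` (`mul_card_sdiff_grow_le`). There are about `C^t t^t`
outcomes of these rounds and `C^t (p / t)^t` sets `F`, so that the number of relevant pairs
`(T, F)` is at most `C^t p^((1 + ε/2) t)` (`card_filter_grow_le`) and the union bound gives a
geometric series with ratio of order `p^(1 - (1 - ε) c)` (`stdGaussian_iUnion_signedDual_le`).

*Stopping at the support.* At `S₀` a further variable decreases the loss by the square of one
Gaussian, which is compared with an estimate of the noise level that has at least `n - k - 1`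
degrees of freedom apart from this Gaussian (`stdGaussian_ratio_tail`). This costs the factor
`1 - ε` in the exponent.

The only probabilistic tool is the exponential moment of the square of a Gaussian. All bad events
are events for the noise alone (`atypicalNoise`).
-/

namespace SparseRegression

/-! ### Gaussian tail bounds -/

open Module in
lemma stdGaussian_map_inner {E ι : Type*} [NormedAddCommGroup E] [InnerProductSpace ℝ E]
    [FiniteDimensional ℝ E] [MeasurableSpace E] [BorelSpace E] [Fintype ι]
    {v : ι → E} (hv : Orthonormal ℝ v) :
    (stdGaussian E).map (fun x => (fun i => inner ℝ (v i) x : ι → ℝ)) =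
      Measure.pi (fun _ : ι => gaussianReal 0 1) := by
  have hmeas : Measurable (fun x : E => (fun i => inner ℝ (v i) x : ι → ℝ)) := by fun_prop
  have key : ((stdGaussian E).map (fun x => (fun i => inner ℝ (v i) x : ι → ℝ))).map
      (WithLp.toLp 2) = stdGaussian (EuclideanSpace ℝ ι) := by
    rw [Measure.map_map (by fun_prop) hmeas]
    apply Measure.ext_of_charFun (E := EuclideanSpace ℝ ι)
    ext t
    have hn : ‖∑ i, t i • v i‖ ^ 2 = ‖t‖ ^ 2 := by
      rw [← real_inner_self_eq_norm_sq, hv.inner_sum, EuclideanSpace.real_norm_sq_eq]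
      simp [pow_two]
    rw [charFun_stdGaussian, ← Complex.ofReal_pow, ← hn, Complex.ofReal_pow,
      ← charFun_stdGaussian (∑ i, t i • v i), charFun_apply, charFun_apply, integral_map]
    · congr 1
      ext x
      congr 3
      simp [PiLp.inner_apply, inner_sum, inner_smul_right, real_inner_comm]
    · fun_prop
    · fun_prop
  rw [← map_pi_eq_stdGaussian] at key
  have h2 := congrArg (fun μ => μ.map (WithLp.ofLp : EuclideanSpace ℝ ι → ι → ℝ)) key
  simp only at h2
  rw [Measure.map_map (by fun_prop) hmeas, Measure.map_map (by fun_prop) (by fun_prop),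
    Measure.map_map (by fun_prop) (by fun_prop)] at h2
  have hid : (WithLp.ofLp : EuclideanSpace ℝ ι → ι → ℝ) ∘ (WithLp.toLp 2) = id := by
    ext x; rfl
  have hl : (WithLp.ofLp : EuclideanSpace ℝ ι → ι → ℝ) ∘
      (WithLp.toLp 2 ∘ fun x : E => (fun i => inner ℝ (v i) x : ι → ℝ)) =
      fun x => (fun i => inner ℝ (v i) x : ι → ℝ) := rfl
  rwa [hl, hid, Measure.map_id] at h2

lemma integral_exp_sq_gaussianReal {a : ℝ} (ha : a < 1 / 2) :
    ∫ x, Real.exp (a * x ^ 2) ∂(gaussianReal 0 1) = (1 - 2 * a) ^ (-(1 / 2) : ℝ) := by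
  rw [integral_gaussianReal_eq_integral_smul (by norm_num)]
  have : ∀ x : ℝ, gaussianPDFReal 0 1 x • Real.exp (a * x ^ 2) =
      (√(2 * Real.pi))⁻¹ * Real.exp (-(1 / 2 - a) * x ^ 2) := by
    intro x
    simp only [gaussianPDFReal, NNReal.coe_one, mul_one, sub_zero, smul_eq_mul]
    rw [mul_assoc, ← Real.exp_add]
    congr 2
    ring
  simp_rw [this]
  rw [integral_const_mul, integral_gaussian, Real.rpow_neg (by linarith), ← Real.sqrt_eq_rpow,
    ← Real.sqrt_inv, ← Real.sqrt_inv, ← Real.sqrt_mul (by positivity)]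
  congr 1
  have : (1 - 2 * a) ≠ 0 := by linarith
  have : (1 / 2 - a) ≠ 0 := by linarith
  have := Real.pi_pos.ne'
  field_simp
  

/-- Chernoff's bound for a diagonal quadratic form in orthonormal coordinates of a Gaussian
vector. -/
lemma stdGaussian_quadratic_tail {E ι : Type*} [NormedAddCommGroup E] [InnerProductSpace ℝ E]
    [FiniteDimensional ℝ E] [MeasurableSpace E] [BorelSpace E] [Fintype ι]
    {v : ι → E} (hv : Orthonormal ℝ v) {a : ι → ℝ} (ha : ∀ i, a i < 1 / 2) (s : ℝ) :
    (stdGaussian E).real {x | s ≤ ∑ i, a i * inner ℝ (v i) x ^ 2} ≤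
      (∏ i, (1 - 2 * a i) ^ (-(1 / 2) : ℝ)) * Real.exp (-s) := by
  have hI : ∫ x, Real.exp (∑ i, a i * inner ℝ (v i) x ^ 2) ∂(stdGaussian E) =
      ∏ i, (1 - 2 * a i) ^ (-(1 / 2) : ℝ) := by
    have h1 := integral_map (μ := stdGaussian E)
      (φ := fun x => (fun i => inner ℝ (v i) x : ι → ℝ)) (by fun_prop)
      (f := fun y : ι → ℝ => Real.exp (∑ i, a i * y i ^ 2))
      (Continuous.aestronglyMeasurable (by fun_prop))
    rw [← h1, stdGaussian_map_inner hv]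
    simp_rw [Real.exp_sum]
    rw [integral_fintype_prod_eq_prod (f := fun i x => Real.exp (a i * x ^ 2))]
    exact Finset.prod_congr rfl fun i _ => integral_exp_sq_gaussianReal (ha i)
  have hpos : 0 < ∏ i, (1 - 2 * a i) ^ (-(1 / 2) : ℝ) :=
    Finset.prod_pos fun i _ => Real.rpow_pos_of_pos (by linarith [ha i]) _
  have hint : Integrable (fun x => Real.exp (∑ i, a i * inner ℝ (v i) x ^ 2)) (stdGaussian E) := by
    by_contra h
    rw [integral_undef h] at hI
    exact hpos.ne hI
  have hM := mul_meas_ge_le_integral_of_nonneg (μ := stdGaussian E)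
    (Filter.Eventually.of_forall fun x => (Real.exp_pos _).le) hint (Real.exp s)
  rw [hI] at hM
  simp only [Real.exp_le_exp] at hM
  rw [Real.exp_neg, ← div_eq_mul_inv, le_div_iff₀ (Real.exp_pos _), mul_comm]
  exact hM

/-- The squared norm of the projection onto a subspace, in an orthonormal basis of the subspace. -/
lemma norm_sq_starProjection_eq_sum {E ι : Type*} [NormedAddCommGroup E] [InnerProductSpace ℝ E]
    [FiniteDimensional ℝ E] [Fintype ι] {V : Submodule ℝ E} (b : OrthonormalBasis ι ℝ V) (x : E) :
    ‖V.starProjection x‖ ^ 2 = ∑ i, inner ℝ ((b i : V) : E) x ^ 2 := by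
  rw [Submodule.starProjection_apply, ← Submodule.coe_norm, ← b.sum_sq_inner_right]
  refine Finset.sum_congr rfl fun i _ => ?_
  rw [Submodule.inner_orthogonalProjectionOnto_eq_of_mem_left]

/-- The squared norm of the projection of a Gaussian vector onto a subspace of dimension at most
`t` exceeds `a` with probability at most `δ^(-t/2) exp (-(1-δ)a/2)`, for every `δ ∈ (0, 1]`. -/
lemma stdGaussian_norm_starProjection_tail {E : Type*} [NormedAddCommGroup E]
    [InnerProductSpace ℝ E] [FiniteDimensional ℝ E] [MeasurableSpace E] [BorelSpace E]
    (V : Submodule ℝ E) {t : ℕ} (ht : Module.finrank ℝ V ≤ t) {δ : ℝ} (hδ : 0 < δ) (hδ1 : δ ≤ 1)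
    (a : ℝ) :
    (stdGaussian E).real {x | a ≤ ‖V.starProjection x‖ ^ 2} ≤
      δ ^ (-(t / 2 : ℝ)) * Real.exp (-((1 - δ) / 2 * a)) := by
  have hv : Orthonormal ℝ (fun i => ((stdOrthonormalBasis ℝ V i : V) : E)) :=
    (stdOrthonormalBasis ℝ V).orthonormal.comp_linearIsometry V.subtypeₗᵢ
  refine le_trans (measureReal_mono ?_) ((stdGaussian_quadratic_tail hv
    (a := fun _ => (1 - δ) / 2) (fun _ => by linarith) ((1 - δ) / 2 * a)).trans ?_)
  · intro x hx
    simp only [Set.mem_ofPred_eq] at hx ⊢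
    rw [← Finset.mul_sum, ← norm_sq_starProjection_eq_sum]
    exact mul_le_mul_of_nonneg_left hx (by linarith)
  · rw [Finset.prod_const, Finset.card_univ, Fintype.card_fin, ← Real.rpow_natCast,
      ← Real.rpow_mul (by linarith)]
    refine mul_le_mul_of_nonneg_right ?_ (Real.exp_pos _).le
    rw [show 1 - 2 * ((1 - δ) / 2) = δ by ring]
    refine Real.rpow_le_rpow_of_exponent_ge hδ hδ1 ?_
    have : (Module.finrank ℝ V : ℝ) ≤ t := by exact_mod_cast ht
    linarith

lemma stdGaussian_sq_inner_tail {E : Type*} [NormedAddCommGroup E]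
    [InnerProductSpace ℝ E] [FiniteDimensional ℝ E] [MeasurableSpace E] [BorelSpace E]
    {v : E} {B : ℝ} (hv : ‖v‖ ^ 2 ≤ B) {δ : ℝ} (hδ : 0 < δ) (hδ1 : δ ≤ 1) {a : ℝ} (ha : 0 < a) :
    (stdGaussian E).real {x | a * B < inner ℝ v x ^ 2} ≤
      δ ^ (-(1 / 2 : ℝ)) * Real.exp (-((1 - δ) / 2 * a)) := by
  refine le_trans (measureReal_mono ?_) ((stdGaussian_norm_starProjection_tail (ℝ ∙ v) (t := 1)
    ((finrank_span_le_card ({v} : Set E)).trans (by simp)) hδ hδ1 a).trans_eq (by norm_num))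
  intro x hx
  simp only [Set.mem_ofPred_eq] at hx ⊢
  have h1 : inner ℝ v x = inner ℝ v ((ℝ ∙ v).starProjection x) := by
    rw [← Submodule.inner_starProjection_left_eq_right,
      Submodule.starProjection_eq_self_iff.2 (Submodule.mem_span_singleton_self v)]
  have h2 : inner ℝ v x ^ 2 ≤ ‖v‖ ^ 2 * ‖(ℝ ∙ v).starProjection x‖ ^ 2 := by
    rw [h1, ← mul_pow, ← sq_abs]
    exact pow_le_pow_left₀ (abs_nonneg _) (abs_real_inner_le_norm _ _) 2
  have h3 : a * B < B * ‖(ℝ ∙ v).starProjection x‖ ^ 2 :=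
    hx.trans_le (h2.trans (mul_le_mul_of_nonneg_right hv (by positivity)))
  by_contra hc
  have hB : 0 ≤ B := (sq_nonneg _).trans hv
  nlinarith [not_le.1 hc]

/-- The norm of a standard Gaussian vector of dimension `n` exceeds `√n + √(2L)` with probability
at most `exp (-L)`. -/
lemma stdGaussian_norm_tail {n : ℕ} (hn : 0 < n) {L : ℝ} (hL : 0 ≤ L) :
    (stdGaussian (EuclideanSpace ℝ (Fin n))).real {x | √n + √(2 * L) ≤ ‖x‖} ≤ Real.exp (-L) := by
  have hn' : (0 : ℝ) < n := by exact_mod_cast hn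
  have hs : 0 < √(n : ℝ) := Real.sqrt_pos.2 hn'
  have hsL : 0 ≤ √(2 * L) := Real.sqrt_nonneg _
  -- the exponent that is optimal up to lower order terms
  set y : ℝ := 1 + √(2 * L) / √n with hy
  have hy1 : 1 ≤ y := by rw [hy]; linarith [div_nonneg hsL hs.le]
  have hy0 : 0 < y := by linarith
  have hsy : √n + √(2 * L) = √n * y := by rw [hy]; field_simp
  have hT := stdGaussian_norm_starProjection_tail (⊤ : Submodule ℝ (EuclideanSpace ℝ (Fin n)))
    (t := n) (by simp) (inv_pos.2 hy0) (inv_le_one_of_one_le₀ hy1) (n * y ^ 2)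
  refine le_trans (measureReal_mono ?_) (hT.trans ?_)
  · intro x hx
    simp only [Set.mem_ofPred_eq, Submodule.starProjection_top, ContinuousLinearMap.id_apply]
      at hx ⊢
    rw [hsy] at hx
    have := pow_le_pow_left₀ (by positivity) hx 2
    rwa [mul_pow, Real.sq_sqrt hn'.le] at this
  · rw [Real.rpow_neg (by positivity), Real.inv_rpow hy0.le, inv_inv,
      Real.rpow_def_of_pos hy0, ← Real.exp_add, Real.exp_le_exp]
    have hlog := Real.log_le_sub_one_of_pos hy0
    have h2L : 2 * L = n * (y - 1) ^ 2 := by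
      rw [hy, add_sub_cancel_left, div_pow, Real.sq_sqrt hn'.le, Real.sq_sqrt (by linarith)]
      field_simp
    have h3 : (1 - y⁻¹) / 2 * (n * y ^ 2) = n * (y ^ 2 - y) / 2 := by field_simp
    rw [h3]
    nlinarith [mul_le_mul_of_nonneg_left hlog hn'.le]

/-- The share of a Gaussian vector that lies in one fixed direction `u`, compared with its part in
`u` and an `m`-dimensional subspace orthogonal to `u`. -/
lemma stdGaussian_ratio_tail {E : Type*} [NormedAddCommGroup E]
    [InnerProductSpace ℝ E] [FiniteDimensional ℝ E] [MeasurableSpace E] [BorelSpace E]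
    {V : Submodule ℝ E} {u : E} (hu : ‖u‖ = 1) (huV : u ∈ Vᗮ) {a δ : ℝ} (ha : 0 ≤ a)
    (hδ : 0 < δ) (hδ1 : δ ≤ 1) :
    (stdGaussian E).real
        {x | a * (inner ℝ u x ^ 2 + ‖V.starProjection x‖ ^ 2) ≤ inner ℝ u x ^ 2} ≤
      δ ^ (-(1 / 2 : ℝ)) * (1 + (1 - δ) * a) ^ (-(Module.finrank ℝ V / 2 : ℝ)) := by
  let b := stdOrthonormalBasis ℝ V
  have hv : Orthonormal ℝ (Sum.elim (fun _ : Unit => u) (fun i => ((b i : V) : E))) := by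
    have hb : Orthonormal ℝ (fun i => ((b i : V) : E)) :=
      b.orthonormal.comp_linearIsometry V.subtypeₗᵢ
    refine ⟨?_, ?_⟩
    · rintro (i | i)
      · exact hu
      · exact hb.1 i
    · rintro (i | i) (j | j) hij
      · exact absurd rfl hij
      · exact Submodule.inner_left_of_mem_orthogonal (b j).2 huV
      · exact Submodule.inner_right_of_mem_orthogonal (b i).2 huV
      · exact hb.2 fun h => hij (by rw [h])
  refine le_trans (measureReal_mono ?_) ((stdGaussian_quadratic_tail hv
    (a := Sum.elim (fun _ => (1 - δ) / 2 * (1 - a)) (fun _ => -((1 - δ) / 2 * a))) ?_ 0).trans ?_)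
  · intro x hx
    simp only [Set.mem_ofPred_eq, Fintype.sum_sum_type, Sum.elim_inl, Sum.elim_inr,
      Finset.univ_unique, Finset.sum_singleton] at hx ⊢
    rw [← Finset.mul_sum, ← norm_sq_starProjection_eq_sum]
    nlinarith
  · rintro (i | i)
    · simp only [Sum.elim_inl]; nlinarith
    · simp only [Sum.elim_inr]; nlinarith
  · simp only [Fintype.prod_sum_type, Sum.elim_inl, Sum.elim_inr, Finset.prod_const,
      Finset.card_univ, Fintype.card_unit, pow_one, Fintype.card_fin, neg_zero, Real.exp_zero,
      mul_one]
    have h1 : 0 ≤ (1 - δ) * a := mul_nonneg (by linarith) ha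
    rw [← Real.rpow_natCast, ← Real.rpow_mul (by linarith)]
    refine mul_le_mul ?_ (le_of_eq ?_) (Real.rpow_nonneg (by linarith) _)
      (Real.rpow_nonneg hδ.le _)
    · refine Real.rpow_le_rpow_of_nonpos hδ (by linarith) (by norm_num)
    · congr 1 <;> ring

/-- A vector with independent `N(0, σ²)` coordinates, divided by `σ`, is a standard Gaussian
vector. -/
lemma map_noise_eq_stdGaussian {n : ℕ} {Ω : Type*} {_ : MeasurableSpace Ω} {P : Measure Ω}
    [IsProbabilityMeasure P] {w : Fin n → Ω → ℝ} {σ : ℝ≥0} (hσ : 0 < σ) (hw : iIndepFun w P)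
    (hlaw : ∀ i, HasLaw (w i) (gaussianReal 0 (σ ^ 2)) P) :
    AEMeasurable (fun ω => (WithLp.toLp 2 fun i => w i ω / σ : EuclideanSpace ℝ (Fin n))) P ∧
    P.map (fun ω => (WithLp.toLp 2 fun i => w i ω / σ : EuclideanSpace ℝ (Fin n))) =
      stdGaussian (EuclideanSpace ℝ (Fin n)) := by
  have hm : ∀ i, AEMeasurable (fun ω => w i ω / σ) P := fun i => (hlaw i).aemeasurable.div_const _
  have hm' : AEMeasurable (fun ω => fun i => w i ω / (σ : ℝ)) P := aemeasurable_pi_lambda _ hm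
  have hσ' : (σ : ℝ) ≠ 0 := by exact_mod_cast hσ.ne'
  refine ⟨(WithLp.measurable_toLp _ _).comp_aemeasurable hm', ?_⟩
  have hind : iIndepFun (fun i ω => w i ω / (σ : ℝ)) P :=
    hw.comp (fun _ x => x / (σ : ℝ)) (fun _ => by fun_prop)
  have hmap := (iIndepFun_iff_map_fun_eq_pi_map hm).1 hind
  have h1 : ∀ i, P.map (fun ω => w i ω / (σ : ℝ)) = gaussianReal 0 1 := by
    intro i
    have h := gaussianReal_map_div_const (μ := 0) (v := σ ^ 2) (σ : ℝ)
    rw [← (hlaw i).map_eq, AEMeasurable.map_map_of_aemeasurable (by fun_prop)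
      (hlaw i).aemeasurable] at h
    rw [show (fun ω => w i ω / (σ : ℝ)) = (fun x => x / (σ : ℝ)) ∘ w i from rfl, h]
    congr 1
    · simp
    · ext; simp [hσ']
  simp_rw [h1] at hmap
  rw [← map_pi_eq_stdGaussian, ← hmap, AEMeasurable.map_map_of_aemeasurable (by fun_prop) hm']
  rfl

/-! ### Dual vectors of a well-conditioned family -/

/-- The family `x` is well conditioned on `A` with constant `N`: the quadratic form
`a ↦ ‖∑_{j ∈ A} a_j x_j‖²` is at least `N ‖a‖²`. -/
def WellConditioned {ι E : Type*} [NormedAddCommGroup E] [InnerProductSpace ℝ E] (x : ι → E)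
    (A : Finset ι) (N : ℝ) : Prop :=
  ∀ a : ι → ℝ, N * ∑ j ∈ A, a j ^ 2 ≤ ‖∑ j ∈ A, a j • x j‖ ^ 2

/-- The dual vector `d_j` of `x_j` in the span of `{x_i : i ∈ A}`: the component of `x_j` orthogonal
to the other `x_i`, scaled such that `⟪d_j, x_j⟫ = 1`. Least squares on the columns in `A` estimates
the `j`-th coefficient by `⟪d_j, y⟫`. -/
noncomputable def dualVec {ι E : Type*} [DecidableEq ι] [NormedAddCommGroup E]
    [InnerProductSpace ℝ E] [FiniteDimensional ℝ E] (x : ι → E) (A : Finset ι) (j : ι) : E :=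
  (‖(Submodule.span ℝ (x '' (A.erase j : Finset ι)))ᗮ.starProjection (x j)‖ ^ 2)⁻¹ •
    (Submodule.span ℝ (x '' (A.erase j : Finset ι)))ᗮ.starProjection (x j)

section dual

variable {ι E : Type*} [DecidableEq ι] [NormedAddCommGroup E] [InnerProductSpace ℝ E]
  [FiniteDimensional ℝ E] {x : ι → E} {A : Finset ι} {N : ℝ}

lemma WellConditioned.mono {ι E : Type*} [NormedAddCommGroup E] [InnerProductSpace ℝ E] {x : ι → E}
    {A B : Finset ι} {N : ℝ} (h : WellConditioned x A N) (hBA : B ⊆ A) :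
    WellConditioned x B N := by
  classical
  intro a
  have := h (fun j => if j ∈ B then a j else 0)
  simpa [ite_pow, ite_smul, Finset.sum_ite_mem, Finset.inter_eq_right.2 hBA] using this

lemma mem_span_image_finset {ι E : Type*} [NormedAddCommGroup E] [InnerProductSpace ℝ E]
    {x : ι → E} {A : Finset ι} {u : E} (hu : u ∈ Submodule.span ℝ (x '' A)) :
    ∃ c : ι → ℝ, u = ∑ i ∈ A, c i • x i := by
  obtain ⟨c, hc⟩ := (Submodule.mem_span_image_finset_iff_exists_fun ℝ).1 hu
  classical
  refine ⟨fun i => if h : i ∈ A then c ⟨i, h⟩ else 0, ?_⟩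
  rw [← hc, ← Finset.sum_coe_sort A]
  exact Finset.sum_congr rfl fun i _ => by simp

lemma column_mem_span {ι E : Type*} [NormedAddCommGroup E] [InnerProductSpace ℝ E]
    {x : ι → E} {A : Finset ι} {i : ι} (hi : i ∈ A) : x i ∈ Submodule.span ℝ (x '' A) :=
  Submodule.subset_span (Set.mem_image_of_mem _ hi)

lemma inner_eq_zero_of_forall_mem {ι E : Type*} [NormedAddCommGroup E] [InnerProductSpace ℝ E]
    {x : ι → E} {A : Finset ι} {u v : E} (hu : u ∈ Submodule.span ℝ (x '' A))
    (h : ∀ i ∈ A, inner ℝ (x i) v = 0) : inner ℝ u v = 0 := by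
  obtain ⟨c, rfl⟩ := mem_span_image_finset hu
  rw [sum_inner]
  exact Finset.sum_eq_zero fun i hi => by rw [real_inner_smul_left, h i hi, mul_zero]

lemma dualVec_mem_span {j : ι} (hj : j ∈ A) :
    dualVec x A j ∈ Submodule.span ℝ (x '' A) := by
  refine Submodule.smul_mem _ _ ?_
  rw [Submodule.starProjection_orthogonal_val]
  refine Submodule.sub_mem _ (column_mem_span hj) ?_
  exact Submodule.span_mono (Set.image_mono (by simp))
    (Submodule.starProjection_apply_mem _ _)

lemma inner_dualVec_of_ne {i j : ι} (hi : i ∈ A) (hij : i ≠ j) :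
    inner ℝ (x i) (dualVec x A j) = 0 := by
  rw [dualVec, real_inner_smul_right]
  rw [Submodule.inner_right_of_mem_orthogonal (column_mem_span (Finset.mem_erase.2 ⟨hij, hi⟩))
    (Submodule.starProjection_apply_mem _ _), mul_zero]

lemma starProjection_orthogonal_ne_zero (hN : 0 < N) (hA : WellConditioned x A N) {j : ι}
    (hj : j ∈ A) :
    (Submodule.span ℝ (x '' (A.erase j : Finset ι)))ᗮ.starProjection (x j) ≠ 0 := by
  intro h
  rw [Submodule.starProjection_orthogonal_val, sub_eq_zero] at h
  obtain ⟨c, hc⟩ := mem_span_image_finset 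
    (Submodule.starProjection_apply_mem (Submodule.span ℝ (x '' (A.erase j : Finset ι))) (x j))
  rw [← h] at hc
  have h1 := hA (fun i => if i = j then 1 else - c i)
  have h2 : ∑ i ∈ A, (if i = j then (1 : ℝ) else - c i) • x i = 0 := by
    have h3 : ∑ i ∈ A.erase j, (if i = j then (1 : ℝ) else - c i) • x i =
        - ∑ i ∈ A.erase j, c i • x i := by
      rw [← Finset.sum_neg_distrib]
      exact Finset.sum_congr rfl fun i hi => by rw [if_neg (Finset.ne_of_mem_erase hi), neg_smul]
    rw [← Finset.add_sum_erase _ _ hj, h3, ← hc, if_pos rfl, one_smul, add_neg_cancel]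
  rw [h2, norm_zero, ← Finset.add_sum_erase _ _ hj] at h1
  have h3 : 0 ≤ ∑ i ∈ A.erase j, (if i = j then (1 : ℝ) else - c i) ^ 2 :=
    Finset.sum_nonneg fun _ _ => sq_nonneg _
  simp only [if_true] at h1
  nlinarith

lemma inner_dualVec_self (hN : 0 < N) (hA : WellConditioned x A N) {j : ι} (hj : j ∈ A) :
    inner ℝ (x j) (dualVec x A j) = 1 := by
  have h0 := starProjection_orthogonal_ne_zero hN hA hj
  set W := Submodule.span ℝ (x '' (A.erase j : Finset ι)) with hW
  have h1 : inner ℝ (x j) (Wᗮ.starProjection (x j)) = ‖Wᗮ.starProjection (x j)‖ ^ 2 := by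
    rw [← real_inner_self_eq_norm_sq, Submodule.inner_starProjection_left_eq_right,
      Submodule.starProjection_eq_self_iff.2 (Submodule.starProjection_apply_mem _ _)]
  rw [dualVec, real_inner_smul_right]
  change (‖Wᗮ.starProjection (x j)‖ ^ 2)⁻¹ * inner ℝ (x j) (Wᗮ.starProjection (x j)) = 1
  rw [h1]
  exact inv_mul_cancel₀ (by positivity)

lemma inner_dualVec (hN : 0 < N) (hA : WellConditioned x A N) {i j : ι} (hi : i ∈ A) (hj : j ∈ A) :
    inner ℝ (x i) (dualVec x A j) = if i = j then 1 else 0 := by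
  split_ifs with h
  · subst h; exact inner_dualVec_self hN hA hj
  · exact inner_dualVec_of_ne hi h

lemma inner_dualVec_sum (hN : 0 < N) (hA : WellConditioned x A N) {j : ι} (hj : j ∈ A)
    (c : ι → ℝ) : inner ℝ (dualVec x A j) (∑ i ∈ A, c i • x i) = c j := by
  rw [inner_sum, Finset.sum_eq_single_of_mem j hj]
  · rw [real_inner_smul_right, real_inner_comm, inner_dualVec_self hN hA hj, mul_one]
  · intro i hi hij
    rw [real_inner_smul_right, real_inner_comm, inner_dualVec_of_ne hi hij, mul_zero]

lemma eq_sum_inner_dualVec (hN : 0 < N) (hA : WellConditioned x A N) {u : E}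
    (hu : u ∈ Submodule.span ℝ (x '' A)) : u = ∑ i ∈ A, inner ℝ (dualVec x A i) u • x i := by
  obtain ⟨c, rfl⟩ := mem_span_image_finset hu
  exact Finset.sum_congr rfl fun i hi => by rw [inner_dualVec_sum hN hA hi]

lemma inner_dualVec_eq_sum (hN : 0 < N) (hA : WellConditioned x A N) {j : ι} (hj : j ∈ A)
    (r : E) : inner ℝ (dualVec x A j) r =
      ∑ i ∈ A, inner ℝ (dualVec x A i) (dualVec x A j) * inner ℝ (x i) r := by
  conv_lhs => rw [eq_sum_inner_dualVec hN hA (dualVec_mem_span hj)]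
  rw [sum_inner]
  exact Finset.sum_congr rfl fun i _ => by rw [real_inner_smul_left]

/-- The dual family of a well-conditioned family is bounded. -/
lemma norm_sum_dualVec_sq_le (hN : 0 < N) (hA : WellConditioned x A N) {T : Finset ι} (hT : T ⊆ A)
    (a : ι → ℝ) : N * ‖∑ j ∈ T, a j • dualVec x A j‖ ^ 2 ≤ ∑ j ∈ T, a j ^ 2 := by
  set u := ∑ j ∈ T, a j • dualVec x A j with hu
  have hmem : u ∈ Submodule.span ℝ (x '' A) :=
    Submodule.sum_mem _ fun j hj => Submodule.smul_mem _ _ (dualVec_mem_span (hT hj))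
  set c : ι → ℝ := fun i => inner ℝ (dualVec x A i) u with hc
  have hexp : u = ∑ i ∈ A, c i • x i := eq_sum_inner_dualVec hN hA hmem
  have hxi : ∀ i ∈ A, inner ℝ (x i) u = if i ∈ T then a i else 0 := by
    intro i hi
    rw [hu, inner_sum, ← Finset.sum_ite_eq T i a]
    refine Finset.sum_congr rfl fun j hj => ?_
    rw [real_inner_smul_right, inner_dualVec hN hA hi (hT hj)]
    split_ifs <;> simp
  have hnorm : ‖u‖ ^ 2 = ∑ i ∈ T, c i * a i := by
    rw [← real_inner_self_eq_norm_sq]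
    conv_lhs => lhs; rw [hexp]
    rw [sum_inner, ← Finset.sum_subset hT]
    · exact Finset.sum_congr rfl fun i hi => by
        rw [real_inner_smul_left, hxi i (hT hi), if_pos hi]
    · intro i hi hiT
      rw [real_inner_smul_left, hxi i hi, if_neg hiT, mul_zero]
  have hCS := Finset.sum_mul_sq_le_sq_mul_sq T c a
  rw [← hnorm] at hCS
  have hcT : N * ∑ i ∈ T, c i ^ 2 ≤ ‖u‖ ^ 2 := by
    refine le_trans ?_ ((hA c).trans_eq (by rw [← hexp]))
    exact mul_le_mul_of_nonneg_left (Finset.sum_le_sum_of_subset_of_nonneg hT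
      fun _ _ _ => sq_nonneg _) hN.le
  have ha0 : 0 ≤ ∑ j ∈ T, a j ^ 2 := Finset.sum_nonneg fun _ _ => sq_nonneg _
  rcases (sq_nonneg ‖u‖).eq_or_lt with h | h
  · rw [← h, mul_zero]; exact ha0
  · have : ‖u‖ ^ 2 * (N * ‖u‖ ^ 2) ≤ ‖u‖ ^ 2 * ∑ j ∈ T, a j ^ 2 := by nlinarith
    exact le_of_mul_le_mul_left this h

lemma sum_inner_dualVec_sq_le (hN : 0 < N) (hA : WellConditioned x A N) {T : Finset ι}
    (hT : T ⊆ A) (u : E) : N * ∑ j ∈ T, inner ℝ (dualVec x A j) u ^ 2 ≤ ‖u‖ ^ 2 := by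
  set s := ∑ j ∈ T, inner ℝ (dualVec x A j) u ^ 2 with hs
  have hs0 : 0 ≤ s := Finset.sum_nonneg fun _ _ => sq_nonneg _
  set v := ∑ j ∈ T, inner ℝ (dualVec x A j) u • dualVec x A j with hv
  have h1 : inner ℝ v u = s := by
    rw [hv, sum_inner, hs]
    exact Finset.sum_congr rfl fun j _ => by rw [real_inner_smul_left, pow_two]
  have h2 : N * ‖v‖ ^ 2 ≤ s := norm_sum_dualVec_sq_le hN hA hT _
  have h3 : s ^ 2 ≤ ‖v‖ ^ 2 * ‖u‖ ^ 2 := by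
    rw [← h1, ← mul_pow, ← sq_abs]
    exact pow_le_pow_left₀ (abs_nonneg _) (abs_real_inner_le_norm _ _) 2
  rcases hs0.eq_or_lt with h | h
  · rw [← h, mul_zero]; positivity
  · have : s * (N * s) ≤ s * ‖u‖ ^ 2 := by nlinarith [sq_nonneg ‖u‖]
    exact le_of_mul_le_mul_left this h

lemma norm_dualVec_sq_le (hN : 0 < N) (hA : WellConditioned x A N) {j : ι} (hj : j ∈ A) :
    ‖dualVec x A j‖ ^ 2 ≤ 1 / N := by
  have := norm_sum_dualVec_sq_le hN hA (Finset.singleton_subset_iff.2 hj) (fun _ => 1)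
  simp only [Finset.sum_singleton, one_smul, one_pow] at this
  rw [le_div_iff₀ hN]; linarith

/-- The directions which the vectors `x_f`, `f ∈ F`, add to the span of `{x_i : i ∈ S}`, made
orthogonal to that span. -/
noncomputable def newDirections {ι E : Type*} [NormedAddCommGroup E] [InnerProductSpace ℝ E]
    [FiniteDimensional ℝ E] (x : ι → E) (S F : Finset ι) : Submodule ℝ E :=
  Submodule.span ℝ ((fun f => (Submodule.span ℝ (x '' S))ᗮ.starProjection (x f)) '' F)

lemma finrank_newDirections_le {ι E : Type*} [NormedAddCommGroup E] [InnerProductSpace ℝ E]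
    [FiniteDimensional ℝ E] {x : ι → E} (S F : Finset ι) :
    Module.finrank ℝ (newDirections x S F) ≤ F.card := by
  classical
  have := finrank_span_finset_le_card (R := ℝ)
    (F.image fun f => (Submodule.span ℝ (x '' S))ᗮ.starProjection (x f))
  rw [Finset.coe_image] at this
  exact this.trans Finset.card_image_le

lemma newDirections_le_orthogonal {ι E : Type*} [NormedAddCommGroup E] [InnerProductSpace ℝ E]
    [FiniteDimensional ℝ E] {x : ι → E} (S F : Finset ι) :
    newDirections x S F ≤ (Submodule.span ℝ (x '' S))ᗮ := by
  rw [newDirections, Submodule.span_le]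
  rintro _ ⟨f, _, rfl⟩
  exact Submodule.starProjection_apply_mem _ _

lemma dualVec_sub_mem_newDirections (hN : 0 < N) {S F : Finset ι}
    (hA : WellConditioned x (S ∪ F) N) {j : ι} (hj : j ∈ S) :
    dualVec x (S ∪ F) j - dualVec x S j ∈ newDirections x S F := by
  set z := dualVec x (S ∪ F) j - dualVec x S j with hz
  have hS : S ⊆ S ∪ F := Finset.subset_union_left
  have hzS : z ∈ (Submodule.span ℝ (x '' S))ᗮ := by
    rw [Submodule.mem_orthogonal]
    intro u hu
    refine inner_eq_zero_of_forall_mem hu fun i hi => ?_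
    rw [hz, inner_sub_right, inner_dualVec hN hA (hS hi) (hS hj),
      inner_dualVec hN (hA.mono hS) hi hj, sub_self]
  have hzA : z ∈ Submodule.span ℝ (x '' (S ∪ F : Finset ι)) :=
    Submodule.sub_mem _ (dualVec_mem_span (hS hj))
      (Submodule.span_mono (Set.image_mono (by simp)) (dualVec_mem_span hj))
  obtain ⟨c, hc⟩ := mem_span_image_finset hzA
  rw [← Submodule.starProjection_eq_self_iff.2 hzS, hc, map_sum]
  refine Submodule.sum_mem _ fun i hi => ?_
  rw [map_smul]
  refine Submodule.smul_mem _ _ ?_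
  by_cases hiS : i ∈ S
  · have : (Submodule.span ℝ (x '' S))ᗮ.starProjection (x i) = 0 :=
      Submodule.starProjection_orthogonal_apply_eq_zero (column_mem_span hiS)
    rw [this]
    exact Submodule.zero_mem _
  · exact Submodule.subset_span ⟨i, by simpa [hiS] using hi, rfl⟩

/-- Adding the vectors in `F` to a family changes its dual vectors little: the change is a linear
map of rank at most `|F|` and of norm at most `N^(-1/2)`. -/
lemma sum_norm_dualVec_sub_sq_le (hN : 0 < N) {S F : Finset ι}
    (hA : WellConditioned x (S ∪ F) N) :
    N * ∑ j ∈ S, ‖dualVec x (S ∪ F) j - dualVec x S j‖ ^ 2 ≤ F.card := by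
  set V := newDirections x S F with hV
  let b := stdOrthonormalBasis ℝ V
  have h1 : ∀ j ∈ S, ‖dualVec x (S ∪ F) j - dualVec x S j‖ ^ 2 =
      ∑ i, inner ℝ (dualVec x (S ∪ F) j) ((b i : V) : E) ^ 2 := by
    intro j hj
    have hmem := dualVec_sub_mem_newDirections hN hA hj
    rw [← hV] at hmem
    rw [← Submodule.starProjection_eq_self_iff.2 hmem, norm_sq_starProjection_eq_sum b]
    refine Finset.sum_congr rfl fun i _ => ?_
    rw [inner_sub_right, real_inner_comm]
    have : inner ℝ ((b i : V) : E) (dualVec x S j) = 0 :=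
      Submodule.inner_left_of_mem_orthogonal (dualVec_mem_span hj)
        (newDirections_le_orthogonal S F (b i).2)
    rw [this, sub_zero]
  rw [Finset.sum_congr rfl h1, Finset.sum_comm, Finset.mul_sum]
  calc ∑ i, N * ∑ j ∈ S, inner ℝ (dualVec x (S ∪ F) j) ((b i : V) : E) ^ 2
      ≤ ∑ i : Fin (Module.finrank ℝ V), (1 : ℝ) := by
        refine Finset.sum_le_sum fun i _ => ?_
        refine (sum_inner_dualVec_sq_le hN hA Finset.subset_union_left _).trans_eq ?_
        rw [← Submodule.coe_norm, b.orthonormal.1 i, one_pow]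
    _ ≤ F.card := by
        simp only [Finset.sum_const, Finset.card_univ, Fintype.card_fin, nsmul_eq_mul, mul_one]
        exact_mod_cast finrank_newDirections_le S F

end dual

/-! ### Residuals -/

section residual

variable {n p : ℕ} {X : Matrix (Fin n) (Fin p) ℝ} {S : Finset (Fin p)}

lemma inner_column_residual {i : Fin p} (hi : i ∈ S) (y : EuclideanSpace ℝ (Fin n)) :
    inner ℝ (column X i) (residual X S y) = 0 :=
  Submodule.inner_right_of_mem_orthogonal (column_mem_span hi)
    (Submodule.starProjection_apply_mem _ _)

lemma sub_residual_mem (y : EuclideanSpace ℝ (Fin n)) :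
    y - residual X S y ∈ Submodule.span ℝ (column X '' (S : Set (Fin p))) := by
  rw [residual, Submodule.starProjection_orthogonal_val, sub_sub_cancel]
  exact Submodule.starProjection_apply_mem _ _

lemma inner_residual_of_mem {y u : EuclideanSpace ℝ (Fin n)}
    (hu : u ∈ Submodule.span ℝ (column X '' (S : Set (Fin p)))) :
    inner ℝ u (residual X S y) = 0 :=
  Submodule.inner_right_of_mem_orthogonal hu (Submodule.starProjection_apply_mem _ _)

/-- The residual is determined by its orthogonality to the selected columns. -/
lemma residual_eq_of_sub_mem {y v : EuclideanSpace ℝ (Fin n)}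
    (h : y - v ∈ Submodule.span ℝ (column X '' (S : Set (Fin p))))
    (hv : v ∈ (Submodule.span ℝ (column X '' (S : Set (Fin p))))ᗮ) : residual X S y = v := by
  rw [residual]
  refine Submodule.eq_starProjection_of_mem_orthogonal hv ?_
  rwa [Submodule.orthogonal_orthogonal]

lemma loss_le_of_sub_mem {y v : EuclideanSpace ℝ (Fin n)}
    (h : y - v ∈ Submodule.span ℝ (column X '' (S : Set (Fin p)))) : loss X y S ≤ ‖v‖ ^ 2 := by
  have h1 : v = residual X S y + (v - residual X S y) := by abel
  have h2 : v - residual X S y ∈ Submodule.span ℝ (column X '' (S : Set (Fin p))) := by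
    have := Submodule.sub_mem _ (sub_residual_mem (X := X) (S := S) y) h
    rwa [sub_sub_sub_cancel_left] at this
  have h3 : inner ℝ (residual X S y) (v - residual X S y) = 0 := by
    rw [real_inner_comm]; exact inner_residual_of_mem h2
  rw [loss]
  conv_rhs => rw [h1]
  rw [norm_add_sq_real, h3]
  nlinarith [sq_nonneg ‖v - residual X S y‖]

/-- Adding the column `j` decreases the loss by at least as much as a step along that column. -/
lemma sq_inner_residual_le (y : EuclideanSpace ℝ (Fin n)) (j : Fin p) :
    inner ℝ (column X j) (residual X S y) ^ 2 ≤
      ‖column X j‖ ^ 2 * (loss X y S - loss X y (insert j S)) := by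
  set x := column X j with hx
  set r := residual X S y with hr
  rcases eq_or_ne (‖x‖ ^ 2) 0 with h0 | h0
  · have : x = 0 := by simpa using h0
    simp [this]
  have hpos : 0 < ‖x‖ ^ 2 := lt_of_le_of_ne (sq_nonneg _) h0.symm
  set c := inner ℝ x r / ‖x‖ ^ 2 with hc
  have h1 : loss X y (insert j S) ≤ ‖r - c • x‖ ^ 2 := by
    refine loss_le_of_sub_mem ?_
    have : y - (r - c • x) = (y - r) + c • x := by abel
    rw [this]
    refine Submodule.add_mem _ ?_ (Submodule.smul_mem _ _
      (column_mem_span (Finset.mem_insert_self _ _)))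
    exact Submodule.span_mono (Set.image_mono (by simp)) (sub_residual_mem y)
  have h2 : ‖r - c • x‖ ^ 2 = loss X y S - inner ℝ x r ^ 2 / ‖x‖ ^ 2 := by
    rw [norm_sub_sq_real, real_inner_smul_right, norm_smul, mul_pow, Real.norm_eq_abs, sq_abs,
      real_inner_comm, loss, ← hr, hc]
    field_simp
    ring
  have h3 : inner ℝ x r ^ 2 / ‖x‖ ^ 2 ≤ loss X y S - loss X y (insert j S) := by linarith
  rw [div_le_iff₀ hpos] at h3
  linarith

/-- The exact decrease of the loss when the column `j` is added. -/
lemma loss_eq_loss_insert_add {j : Fin p} (hr : residual X S (column X j) ≠ 0)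
    (y : EuclideanSpace ℝ (Fin n)) :
    loss X y S = inner ℝ (‖residual X S (column X j)‖⁻¹ • residual X S (column X j)) y ^ 2
      + loss X y (insert j S) := by
  set r := residual X S (column X j) with hrdef
  set q := residual X (insert j S) y with hq
  have hr0 : ‖r‖ ≠ 0 := norm_ne_zero_iff.2 hr
  have hrS : r ∈ (Submodule.span ℝ (column X '' (S : Set (Fin p))))ᗮ :=
    Submodule.starProjection_apply_mem _ _
  have hxr : column X j - r ∈ Submodule.span ℝ (column X '' (S : Set (Fin p))) :=
    sub_residual_mem _
  have hmono : Submodule.span ℝ (column X '' (S : Set (Fin p))) ≤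
      Submodule.span ℝ (column X '' ((insert j S : Finset (Fin p)) : Set (Fin p))) :=
    Submodule.span_mono (Set.image_mono (by simp))
  have hrmem : r ∈ Submodule.span ℝ
      (column X '' ((insert j S : Finset (Fin p)) : Set (Fin p))) := by
    have := Submodule.sub_mem _ (column_mem_span (x := column X) (Finset.mem_insert_self j S))
      (hmono hxr)
    rwa [sub_sub_cancel] at this
  have hrq : inner ℝ r q = 0 := inner_residual_of_mem hrmem
  set c := inner ℝ r y / ‖r‖ ^ 2 with hc
  have hres : residual X S y = c • r + q := by
    refine residual_eq_of_sub_mem ?_ (Submodule.add_mem _ (Submodule.smul_mem _ _ hrS) ?_)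
    · obtain ⟨a, s, hs, has⟩ : ∃ a : ℝ, ∃ s ∈ Submodule.span ℝ (column X '' (S : Set (Fin p))),
          y - q = a • r + s := by
        have h := sub_residual_mem (X := X) (S := insert j S) y
        rw [Finset.coe_insert, Set.image_insert_eq, Submodule.mem_span_insert] at h
        obtain ⟨a, s, hs, h⟩ := h
        refine ⟨a, a • (column X j - r) + s,
          Submodule.add_mem _ (Submodule.smul_mem _ _ hxr) hs, ?_⟩
        rw [hq, h, smul_sub]; abel
      have hac : a = c := by
        have h1 : inner ℝ r (y - q) = a * ‖r‖ ^ 2 := by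
          rw [has, inner_add_right, real_inner_smul_right, real_inner_self_eq_norm_sq,
            Submodule.inner_left_of_mem_orthogonal hs hrS, add_zero]
        rw [inner_sub_right, hrq, sub_zero] at h1
        rw [hc, h1]; field_simp
      have : y - (c • r + q) = s := by
        rw [← hac, add_comm, ← sub_sub, has]; abel
      rwa [this]
    · exact Submodule.orthogonal_le hmono (Submodule.starProjection_apply_mem _ _)
  rw [loss, loss, hres, norm_add_sq_real, real_inner_smul_left, hrq, norm_smul, mul_pow,
    Real.norm_eq_abs, sq_abs, real_inner_smul_left, ← hq, hc]
  field_simp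
  ring

end residual

/-! ### The normal equations at a wrong support -/

section normal

variable {n p : ℕ} {X : Matrix (Fin n) (Fin p) ℝ} {S S₀ : Finset (Fin p)} {β : Fin p → ℝ} {N : ℝ}

/-- The least-squares estimates on `S₀ ∪ S` of the missed coefficients, expressed through the
correlations of the residual at `S` with the missed columns. -/
lemma add_inner_dualVec_eq_sum (hN : 0 < N) (hA : WellConditioned (column X) (S₀ ∪ (S \ S₀)) N)
    (w : EuclideanSpace ℝ (Fin n)) {j : Fin p} (hj : j ∈ S₀ \ S) :
    β j + inner ℝ (dualVec (column X) (S₀ ∪ (S \ S₀)) j) w =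
      ∑ i ∈ S₀ \ S, inner ℝ (dualVec (column X) (S₀ ∪ (S \ S₀)) i)
        (dualVec (column X) (S₀ ∪ (S \ S₀)) j) *
          inner ℝ (column X i) (residual X S (∑ i ∈ S₀, β i • column X i + w)) := by
  set A := S₀ ∪ (S \ S₀) with hAdef
  set y := ∑ i ∈ S₀, β i • column X i + w with hy
  set r := residual X S y with hr
  have hjA : j ∈ A := Finset.mem_union_left _ (Finset.mem_sdiff.1 hj).1
  have hSA : S ⊆ A := fun i hi => by by_cases h : i ∈ S₀ <;> simp [hAdef, hi, h]
  have h1 : inner ℝ (dualVec (column X) A j) r = inner ℝ (dualVec (column X) A j) y := by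
    obtain ⟨c, hc⟩ := mem_span_image_finset (sub_residual_mem (X := X) (S := S) y)
    have : r = y - ∑ i ∈ S, c i • column X i := by rw [← hc, hr]; abel
    rw [this, inner_sub_right, inner_sum, Finset.sum_eq_zero, sub_zero]
    intro i hi
    rw [real_inner_smul_right, real_inner_comm, inner_dualVec_of_ne (hSA hi), mul_zero]
    rintro rfl
    exact (Finset.mem_sdiff.1 hj).2 hi
  have h2 : inner ℝ (dualVec (column X) A j) y = β j + inner ℝ (dualVec (column X) A j) w := by
    rw [hy, inner_add_right, inner_sum, Finset.sum_eq_single_of_mem j (Finset.mem_sdiff.1 hj).1,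
      real_inner_smul_right, real_inner_comm, inner_dualVec_self hN hA hjA, mul_one]
    intro i hi hij
    rw [real_inner_smul_right, real_inner_comm,
      inner_dualVec_of_ne (Finset.mem_union_left _ hi) hij, mul_zero]
  rw [← h2, ← h1, inner_dualVec_eq_sum hN hA hjA]
  symm
  refine Finset.sum_subset (fun i hi => Finset.mem_union_left _ (Finset.mem_sdiff.1 hi).1) ?_
  intro i hi hiT
  have hiS : i ∈ S := by
    by_contra h
    simp only [hAdef, Finset.mem_union, Finset.mem_sdiff] at hi hiT
    tauto
  rw [inner_column_residual hiS, mul_zero]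

/-- The loss at `S` is at most the squared norm of the noise plus the part explained by the missed
columns. -/
lemma loss_le_sum_add (hN : 0 < N) (hA : WellConditioned (column X) (S₀ ∪ (S \ S₀)) N)
    (w : EuclideanSpace ℝ (Fin n)) :
    loss X (∑ i ∈ S₀, β i • column X i + w) S ≤
      (∑ i ∈ S₀ \ S, inner ℝ (column X i)
        (residual X S (∑ i ∈ S₀, β i • column X i + w)) ^ 2) / N + ‖w‖ ^ 2 := by
  set A := S₀ ∪ (S \ S₀) with hAdef
  set y := ∑ i ∈ S₀, β i • column X i + w with hy
  set r := residual X S y with hr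
  set ξ : Fin p → ℝ := fun i => inner ℝ (column X i) r with hξ
  set q := ∑ i ∈ S₀ \ S, ξ i • dualVec (column X) A i with hq
  have hTA : S₀ \ S ⊆ A := fun i hi => Finset.mem_union_left _ (Finset.mem_sdiff.1 hi).1
  have hSA : S ⊆ A := fun i hi => by by_cases h : i ∈ S₀ <;> simp [hAdef, hi, h]
  have hqA : q ∈ Submodule.span ℝ (column X '' (A : Set (Fin p))) :=
    Submodule.sum_mem _ fun i hi => Submodule.smul_mem _ _ (dualVec_mem_span (hTA hi))
  have hperp : ∀ i ∈ A, inner ℝ (column X i) (r - q) = 0 := by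
    intro i hi
    rw [inner_sub_right, hq, inner_sum, sub_eq_zero]
    by_cases hiT : i ∈ S₀ \ S
    · rw [Finset.sum_eq_single_of_mem i hiT, real_inner_smul_right, inner_dualVec_self hN hA hi,
        mul_one]
      intro j hj hji
      rw [real_inner_smul_right, inner_dualVec_of_ne hi hji.symm, mul_zero]
    · have hiS : i ∈ S := by
        by_contra h
        simp only [hAdef, Finset.mem_union, Finset.mem_sdiff] at hi hiT
        tauto
      rw [inner_column_residual hiS, Finset.sum_eq_zero]
      intro j hj
      rw [real_inner_smul_right, inner_dualVec_of_ne hi, mul_zero]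
      rintro rfl
      exact hiT hj
  have haA : w - (r - q) ∈ Submodule.span ℝ (column X '' (A : Set (Fin p))) := by
    have : w - (r - q) = (y - r) + q - ∑ i ∈ S₀, β i • column X i := by rw [hy]; abel
    rw [this]
    refine Submodule.sub_mem _ (Submodule.add_mem _ ?_ hqA) ?_
    · exact Submodule.span_mono (Set.image_mono (by simpa using hSA)) (sub_residual_mem y)
    · exact Submodule.sum_mem _ fun i hi => Submodule.smul_mem _ _
        (column_mem_span (Finset.mem_union_left _ hi))
  have h1 : ‖r‖ ^ 2 = ‖q‖ ^ 2 + ‖r - q‖ ^ 2 := by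
    have : r = q + (r - q) := by abel
    conv_lhs => rw [this]
    rw [norm_add_sq_real, inner_eq_zero_of_forall_mem hqA hperp]; ring
  have h2 : ‖w‖ ^ 2 = ‖w - (r - q)‖ ^ 2 + ‖r - q‖ ^ 2 := by
    have : w = (w - (r - q)) + (r - q) := by abel
    conv_lhs => rw [this]
    rw [norm_add_sq_real, inner_eq_zero_of_forall_mem haA hperp]; ring
  have h3 : ‖q‖ ^ 2 ≤ (∑ i ∈ S₀ \ S, ξ i ^ 2) / N := by
    rw [le_div_iff₀ hN, mul_comm]
    exact norm_sum_dualVec_sq_le hN hA hTA ξ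
  rw [loss, ← hr, h1]
  nlinarith [sq_nonneg ‖w - (r - q)‖]

end normal

/-! ### Signed sums of dual vectors -/

section signed

variable {ι E : Type*} [DecidableEq ι] [NormedAddCommGroup E] [InnerProductSpace ℝ E]
  [FiniteDimensional ℝ E] {x : ι → E} {A : Finset ι} {N : ℝ}

/-- The sum over `T` of the dual vectors, with the signs of the coefficients `β`. -/
noncomputable def signedDual (x : ι → E) (A : Finset ι) (β : ι → ℝ) (T : Finset ι) : E :=
  ∑ j ∈ T, (if 0 ≤ β j then (1 : ℝ) else -1) • dualVec x A j

lemma sign_mul_self_eq_abs (a : ℝ) : (if 0 ≤ a then (1 : ℝ) else -1) * a = |a| := by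
  split_ifs with h
  · rw [one_mul, abs_of_nonneg h]
  · rw [abs_of_neg (not_le.1 h)]; ring

lemma norm_signedDual_sq_le (hN : 0 < N) (hA : WellConditioned x A N) {T : Finset ι} (hT : T ⊆ A)
    (β : ι → ℝ) : ‖signedDual x A β T‖ ^ 2 ≤ T.card / N := by
  rw [le_div_iff₀ hN, mul_comm]
  refine (norm_sum_dualVec_sq_le hN hA hT _).trans_eq ?_
  rw [Finset.sum_congr rfl (g := fun _ => (1 : ℝ)) fun j _ => by split_ifs <;> norm_num]
  simp

lemma inner_signedDual (β : ι → ℝ) (T : Finset ι) (w : E) :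
    inner ℝ (signedDual x A β T) w =
      ∑ j ∈ T, (if 0 ≤ β j then (1 : ℝ) else -1) * inner ℝ (dualVec x A j) w := by
  rw [signedDual, sum_inner]
  exact Finset.sum_congr rfl fun j _ => by rw [real_inner_smul_left]

/-- The Gram matrix of the dual vectors has norm at most `1 / N`; here it is applied to a vector of
signs and a bounded vector. -/
lemma sum_sign_mul_gram_le (hN : 0 < N) (hA : WellConditioned x A N) {U B : Finset ι} (hU : U ⊆ A)
    (hB : B ⊆ A) (β : ι → ℝ) {ξ : ι → ℝ} {Ξ : ℝ} (hΞ : 0 ≤ Ξ) (hξ : ∀ i ∈ B, |ξ i| ≤ Ξ) :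
    ∑ j ∈ U, (if 0 ≤ β j then (1 : ℝ) else -1) *
      ∑ i ∈ B, inner ℝ (dualVec x A i) (dualVec x A j) * ξ i ≤ Ξ / N * √(U.card * B.card) := by
  set q := ∑ i ∈ B, ξ i • dualVec x A i with hq
  have h1 : ∑ j ∈ U, (if 0 ≤ β j then (1 : ℝ) else -1) *
      ∑ i ∈ B, inner ℝ (dualVec x A i) (dualVec x A j) * ξ i =
      inner ℝ (signedDual x A β U) q := by
    rw [inner_signedDual]
    refine Finset.sum_congr rfl fun j _ => ?_
    rw [hq, inner_sum]
    congr 1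
    exact Finset.sum_congr rfl fun i _ => by rw [real_inner_smul_right, real_inner_comm, mul_comm]
  have h2 : ‖q‖ ^ 2 ≤ B.card * Ξ ^ 2 / N := by
    rw [le_div_iff₀ hN, mul_comm]
    refine (norm_sum_dualVec_sq_le hN hA hB ξ).trans ?_
    rw [← nsmul_eq_mul]
    exact Finset.sum_le_card_nsmul _ _ _ fun i hi => by
      rw [← sq_abs]; exact pow_le_pow_left₀ (abs_nonneg _) (hξ i hi) 2
  have h3 := norm_signedDual_sq_le hN hA hU β
  rw [h1]
  refine (real_inner_le_norm _ _).trans ?_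
  refine abs_le_of_sq_le_sq' ?_ (by positivity) |>.2
  rw [mul_pow, mul_pow, div_pow, Real.sq_sqrt (by positivity)]
  refine (mul_le_mul h3 h2 (sq_nonneg _) (by positivity)).trans_eq ?_
  field_simp

/-- If the normal equations hold on `T` with bounded right-hand sides, then the noise along the
signed sum of the dual vectors is large. -/
lemma card_mul_le_abs_inner_signedDual (hN : 0 < N) (hA : WellConditioned x A N) {T : Finset ι}
    (hT : T ⊆ A) {β ξ : ι → ℝ} {w : E} {b Ξ : ℝ} (hΞ : 0 ≤ Ξ) (hξ : ∀ i ∈ T, |ξ i| ≤ Ξ)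
    (hβ : ∀ j ∈ T, b ≤ |β j|)
    (heq : ∀ j ∈ T, β j + inner ℝ (dualVec x A j) w =
      ∑ i ∈ T, inner ℝ (dualVec x A i) (dualVec x A j) * ξ i) :
    T.card * (b - Ξ / N) ≤ |inner ℝ (signedDual x A β T) w| := by
  have h1 := sum_sign_mul_gram_le hN hA hT hT β hΞ hξ
  rw [Finset.sum_congr rfl fun j hj => by rw [← heq j hj, mul_add, sign_mul_self_eq_abs],
    Finset.sum_add_distrib, ← inner_signedDual, Real.sqrt_mul_self (by positivity)] at h1
  have h2 : T.card * b ≤ ∑ j ∈ T, |β j| := by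
    rw [← nsmul_eq_mul]; exact Finset.card_nsmul_le_sum _ _ _ hβ
  have h3 := neg_abs_le (inner ℝ (signedDual x A β T) w)
  linarith

/-- If the normal equations hold on `T`, and the noise in the coordinates outside `W' ⊆ T` is too
small to explain them, then these coordinates are coupled to those in `W'`: if they are decoupled
from `W ⊆ W'`, then `W' \ W` is not much smaller than `T \ W'`. -/
lemma card_sdiff_mul_le (hN : 0 < N) (hA : WellConditioned x A N) {T W W' : Finset ι}
    (hT : T ⊆ A) (hWW' : W ⊆ W') (hW'T : W' ⊆ T) {β ξ : ι → ℝ} {w : E} {b η Ξ κ : ℝ} (hΞ : 0 ≤ Ξ)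
    (hκ : 0 ≤ κ) (hξ : ∀ i ∈ T, |ξ i| ≤ Ξ) (hβ : ∀ j ∈ T, b ≤ |β j|)
    (heq : ∀ j ∈ T, β j + inner ℝ (dualVec x A j) w =
      ∑ i ∈ T, inner ℝ (dualVec x A i) (dualVec x A j) * ξ i)
    (hη : ∀ j ∈ T \ W', |inner ℝ (dualVec x A j) w| ≤ η)
    (hW : ∀ j ∈ T \ W', T.card * N ^ 2 *
      ∑ i ∈ W, inner ℝ (dualVec x A i) (dualVec x A j) ^ 2 ≤ κ ^ 2) :
    (T \ W').card * (b - η) ≤ Ξ / N * ((T \ W').card +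
      √((T \ W').card * (W' \ W).card) + κ * (T \ W').card) := by
  set U := T \ W' with hU
  have hUT : U ⊆ T := Finset.sdiff_subset
  have hVT : W' \ W ⊆ T := Finset.sdiff_subset.trans hW'T
  have hWT : W ⊆ T := hWW'.trans hW'T
  have hsplit : ∀ f : ι → ℝ, ∑ i ∈ T, f i = ∑ i ∈ U, f i + ∑ i ∈ W' \ W, f i + ∑ i ∈ W, f i := by
    intro f
    rw [add_assoc, Finset.sum_sdiff hWW', Finset.sum_sdiff hW'T]
  have h1 := sum_sign_mul_gram_le hN hA (hUT.trans hT) (hUT.trans hT) β hΞ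
    (fun i hi => hξ i (hUT hi))
  have h2 := sum_sign_mul_gram_le hN hA (hUT.trans hT) (hVT.trans hT) β hΞ
    (fun i hi => hξ i (hVT hi))
  rw [Real.sqrt_mul_self (by positivity)] at h1
  have h3 : ∀ j ∈ U, (if 0 ≤ β j then (1 : ℝ) else -1) *
      ∑ i ∈ W, inner ℝ (dualVec x A i) (dualVec x A j) * ξ i ≤ Ξ / N * κ := by
    intro j hj
    have hTpos : (0 : ℝ) < T.card := by
      exact_mod_cast Finset.card_pos.2 ⟨j, hUT hj⟩
    have hle : (if 0 ≤ β j then (1 : ℝ) else -1) *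
      ∑ i ∈ W, inner ℝ (dualVec x A i) (dualVec x A j) * ξ i ≤
        |∑ i ∈ W, inner ℝ (dualVec x A i) (dualVec x A j) * ξ i| := by
      split_ifs
      · rw [one_mul]; exact le_abs_self _
      · rw [neg_one_mul]; exact neg_le_abs _
    refine hle.trans (abs_le_of_sq_le_sq ?_ (by positivity))
    refine (Finset.sum_mul_sq_le_sq_mul_sq _ _ _).trans ?_
    have hs : ∑ i ∈ W, ξ i ^ 2 ≤ T.card * Ξ ^ 2 := by
      refine (Finset.sum_le_card_nsmul _ _ (Ξ ^ 2) fun i hi => ?_).trans ?_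
      · rw [← sq_abs]; exact pow_le_pow_left₀ (abs_nonneg _) (hξ i (hWT hi)) 2
      · rw [nsmul_eq_mul]
        exact mul_le_mul_of_nonneg_right (by exact_mod_cast Finset.card_le_card hWT) (sq_nonneg _)
    have hk : ∑ i ∈ W, inner ℝ (dualVec x A i) (dualVec x A j) ^ 2 ≤ κ ^ 2 / (T.card * N ^ 2) := by
      rw [le_div_iff₀ (by positivity), mul_comm]; exact hW j hj
    refine (mul_le_mul hk hs (Finset.sum_nonneg fun _ _ => sq_nonneg _) (by positivity)).trans_eq ?_
    field_simp
  have h4 : U.card * (b - η) ≤ ∑ j ∈ U, (if 0 ≤ β j then (1 : ℝ) else -1) *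
      (β j + inner ℝ (dualVec x A j) w) := by
    rw [← nsmul_eq_mul]
    refine Finset.card_nsmul_le_sum _ _ _ fun j hj => ?_
    rw [mul_add, sign_mul_self_eq_abs]
    have h5 := hβ j (hUT hj)
    have h6 := abs_le.1 (hη j hj)
    split_ifs <;> linarith [h6.1, h6.2]
  refine h4.trans ?_
  rw [Finset.sum_congr rfl fun j hj => by rw [heq j (hUT hj), hsplit, mul_add, mul_add],
    Finset.sum_add_distrib, Finset.sum_add_distrib]
  have h5 := Finset.sum_le_card_nsmul U _ _ h3
  rw [nsmul_eq_mul] at h5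
  nlinarith

end signed

/-! ### Growing sets -/

section grow

/-- The set obtained from `∅` in `m` rounds, where in each round the elements of `T` that are
eligible for the current set `W`, i.e. those in `Y W`, are added to `W`. -/
def grow {ι : Type*} [DecidableEq ι] (Y : Finset ι → Finset ι) (T : Finset ι) : ℕ → Finset ι
  | 0 => ∅
  | m + 1 => grow Y T m ∪ (T ∩ Y (grow Y T m))

variable {ι : Type*} [DecidableEq ι] {Y : Finset ι → Finset ι} {T : Finset ι}

lemma grow_subset (m : ℕ) : grow Y T m ⊆ T := by
  induction m with
  | zero => simp [grow]
  | succ m ih => exact Finset.union_subset ih Finset.inter_subset_left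

lemma pow_mul_card_sdiff_grow_le {υ : ℝ} (hυ : 0 ≤ υ)
    (h : ∀ m, υ * (T \ grow Y T (m + 1)).card ≤ (grow Y T (m + 1) \ grow Y T m).card) (m : ℕ) :
    (1 + υ) ^ m * (T \ grow Y T m).card ≤ T.card := by
  induction m with
  | zero => simp [grow]
  | succ m ih =>
    have hsub : grow Y T m ⊆ grow Y T (m + 1) := Finset.subset_union_left
    have h1 : (T \ grow Y T m).card =
        (T \ grow Y T (m + 1)).card + (grow Y T (m + 1) \ grow Y T m).card := by
      rw [Finset.card_sdiff_of_subset (grow_subset _), Finset.card_sdiff_of_subset (grow_subset _),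
        Finset.card_sdiff_of_subset hsub]
      have := Finset.card_le_card hsub
      have := Finset.card_le_card (grow_subset (Y := Y) (T := T) (m + 1))
      omega
    have h2 : (1 + υ) * (T \ grow Y T (m + 1)).card ≤ ((T \ grow Y T m).card : ℝ) := by
      rw [h1]; push_cast; linarith [h m]
    refine le_trans ?_ ih
    rw [pow_succ, mul_assoc]
    exact mul_le_mul_of_nonneg_left h2 (by positivity)

lemma sum_powerset_pow_card_le {ι : Type*} (s : Finset ι) {a : ℝ} (ha : 0 ≤ a) :
    ∑ V ∈ s.powerset, a ^ V.card ≤ Real.exp (a * s.card) := by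
  have h := Finset.sum_pow_mul_eq_add_pow a 1 s
  simp only [one_pow, mul_one] at h
  rw [h, mul_comm, Real.exp_nat_mul]
  exact pow_le_pow_left₀ (by linarith) (Real.add_one_le_exp a) _

/-- Weighted count of the sets that can arise in `m` rounds. -/
lemma sum_grow_le [Fintype ι] {t : ℕ} (ht : 0 < t) {B : ℝ} (hY : ∀ W, W.card ≤ t → (Y W).card ≤ B)
    (m : ℕ) :
    ∑ W ∈ (Finset.univ.filter fun T : Finset ι => T.card = t).image (fun T => grow Y T m),
      ((t : ℝ)⁻¹) ^ W.card ≤ Real.exp (m * (B / t)) := by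
  have ht' : (0 : ℝ) < t := by exact_mod_cast ht
  induction m with
  | zero =>
    simp only [grow, Nat.cast_zero, zero_mul, Real.exp_zero]
    refine (Finset.sum_le_sum_of_subset_of_nonneg (t := {∅}) ?_ fun _ _ _ => by positivity).trans ?_
    · intro W hW
      obtain ⟨_, _, rfl⟩ := Finset.mem_image.1 hW
      simp
    · simp
  | succ m ih =>
    set 𝒲 := (Finset.univ.filter fun T : Finset ι => T.card = t).image (fun T => grow Y T m) with h𝒲
    have hsub : (Finset.univ.filter fun T : Finset ι => T.card = t).image
        (fun T => grow Y T (m + 1)) ⊆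
        (𝒲.sigma fun W => (Y W \ W).powerset).image fun q => q.1 ∪ q.2 := by
      intro W hW
      obtain ⟨T, hT, rfl⟩ := Finset.mem_image.1 hW
      refine Finset.mem_image.2 ⟨⟨grow Y T m, (T ∩ Y (grow Y T m)) \ grow Y T m⟩, ?_, ?_⟩
      · simp only [Finset.mem_sigma, Finset.mem_powerset]
        refine ⟨Finset.mem_image_of_mem _ hT, ?_⟩
        exact Finset.sdiff_subset_sdiff Finset.inter_subset_right le_rfl
      · simp [grow]
    refine (Finset.sum_le_sum_of_subset_of_nonneg hsub fun _ _ _ => by positivity).trans ?_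
    refine (Finset.sum_image_le_of_nonneg ?_).trans ?_
    · intro _ _; positivity
    rw [Finset.sum_sigma]
    calc ∑ W ∈ 𝒲, ∑ V ∈ (Y W \ W).powerset, ((t : ℝ)⁻¹) ^ (W ∪ V).card
        ≤ ∑ W ∈ 𝒲, ((t : ℝ)⁻¹) ^ W.card * Real.exp (B / t) := by
          refine Finset.sum_le_sum fun W hW => ?_
          obtain ⟨T, hT, rfl⟩ := Finset.mem_image.1 hW
          have hcard : (grow Y T m).card ≤ t :=
            (Finset.card_le_card (grow_subset m)).trans (Finset.mem_filter.1 hT).2.le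
          have h1 : ∀ V ∈ (Y (grow Y T m) \ grow Y T m).powerset,
              ((t : ℝ)⁻¹) ^ (grow Y T m ∪ V).card =
                ((t : ℝ)⁻¹) ^ (grow Y T m).card * ((t : ℝ)⁻¹) ^ V.card := by
            intro V hV
            rw [Finset.card_union_of_disjoint, pow_add]
            exact Finset.disjoint_of_subset_right (Finset.mem_powerset.1 hV) Finset.disjoint_sdiff
          rw [Finset.sum_congr rfl h1, ← Finset.mul_sum]
          refine mul_le_mul_of_nonneg_left ?_ (by positivity)
          refine (sum_powerset_pow_card_le _ (by positivity)).trans ?_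
          rw [Real.exp_le_exp, inv_mul_eq_div]
          have h2 : ((Y (grow Y T m) \ grow Y T m).card : ℝ) ≤ B :=
            le_trans (by exact_mod_cast Finset.card_le_card Finset.sdiff_subset) (hY _ hcard)
          gcongr
      _ ≤ Real.exp (m * (B / t)) * Real.exp (B / t) := by
          rw [← Finset.sum_mul]
          exact mul_le_mul_of_nonneg_right ih (Real.exp_pos _).le
      _ = Real.exp ((m + 1 : ℕ) * (B / t)) := by
          rw [← Real.exp_add]; push_cast; ring_nf

/-- A bound for the number of sets of size at most `r`, with a parameter `t` that is to be chosen of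
the same order as `r` or larger. -/
lemma card_filter_card_le {ι : Type*} [Fintype ι] {t : ℕ} (ht : 0 < t)
    (htp : t ≤ Fintype.card ι) (r : ℝ) :
    ((Finset.univ.filter fun U : Finset ι => (U.card : ℝ) ≤ r).card : ℝ) ≤
      Real.exp t * ((Fintype.card ι : ℝ) / t) ^ r := by
  have ht' : (0 : ℝ) < t := by exact_mod_cast ht
  have hp' : (0 : ℝ) < Fintype.card ι := by exact_mod_cast ht.trans_le htp
  have htp' : (t : ℝ) ≤ Fintype.card ι := by exact_mod_cast htp
  have h := sum_powerset_pow_card_le (Finset.univ : Finset ι) (a := (t : ℝ) / Fintype.card ι)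
    (by positivity)
  rw [Finset.card_univ, div_mul_cancel₀ _ hp'.ne', Finset.powerset_univ] at h
  have h1 : ∀ U ∈ Finset.univ.filter (fun U : Finset ι => (U.card : ℝ) ≤ r),
      ((t : ℝ) / Fintype.card ι) ^ r ≤ ((t : ℝ) / Fintype.card ι) ^ U.card := by
    intro U hU
    rw [← Real.rpow_natCast]
    exact Real.rpow_le_rpow_of_exponent_ge (by positivity) ((div_le_one hp').2 htp')
      (Finset.mem_filter.1 hU).2
  have h2 := (Finset.card_nsmul_le_sum _ _ _ h1).trans
    ((Finset.sum_le_sum_of_subset_of_nonneg (Finset.filter_subset _ _)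
      fun _ _ _ => by positivity).trans h)
  rw [nsmul_eq_mul] at h2
  have h3 : ((Fintype.card ι : ℝ) / t) ^ r = (((t : ℝ) / Fintype.card ι) ^ r)⁻¹ := by
    rw [← Real.inv_rpow (by positivity), inv_div]
  rw [h3, ← div_eq_mul_inv, le_div_iff₀ (by positivity)]
  exact h2

/-- The number of sets of size `t` of which all but `r` elements are reached in `m` rounds. -/
lemma card_filter_grow_le [Fintype ι] {t : ℕ} (ht : 0 < t) (htp : t ≤ Fintype.card ι) {B : ℝ}
    (hY : ∀ W, W.card ≤ t → (Y W).card ≤ B) (m : ℕ) {r : ℝ} :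
    ((Finset.univ.filter fun T : Finset ι =>
      T.card = t ∧ ((T \ grow Y T m).card : ℝ) ≤ r).card : ℝ) ≤
      (t : ℝ) ^ t * Real.exp (m * (B / t)) * (Real.exp t * ((Fintype.card ι : ℝ) / t) ^ r) := by
  have ht' : (0 : ℝ) < t := by exact_mod_cast ht
  have ht1 : (1 : ℝ) ≤ t := by exact_mod_cast ht
  set 𝒲 := (Finset.univ.filter fun T : Finset ι => T.card = t).image (fun T => grow Y T m) with h𝒲
  have h1 : (𝒲.card : ℝ) ≤ (t : ℝ) ^ t * Real.exp (m * (B / t)) := by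
    have h2 : ∀ W ∈ 𝒲, ((t : ℝ)⁻¹) ^ t ≤ ((t : ℝ)⁻¹) ^ W.card := by
      intro W hW
      obtain ⟨T, hT, rfl⟩ := Finset.mem_image.1 hW
      exact pow_le_pow_of_le_one (by positivity) (inv_le_one_of_one_le₀ ht1)
        ((Finset.card_le_card (grow_subset m)).trans (Finset.mem_filter.1 hT).2.le)
    have h3 := (Finset.card_nsmul_le_sum _ _ _ h2).trans (sum_grow_le ht hY m)
    rw [nsmul_eq_mul, inv_pow, ← div_eq_mul_inv, div_le_iff₀ (by positivity)] at h3
    linarith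
  have h4 : (Finset.univ.filter fun T : Finset ι =>
      T.card = t ∧ ((T \ grow Y T m).card : ℝ) ≤ r).card ≤
      (𝒲 ×ˢ Finset.univ.filter fun U : Finset ι => (U.card : ℝ) ≤ r).card := by
    refine Finset.card_le_card_of_injOn (fun T => (grow Y T m, T \ grow Y T m)) ?_ ?_
    · intro T hT
      have hT' := (Finset.mem_filter.1 hT).2
      refine Finset.mem_product.2 ⟨Finset.mem_image_of_mem _ ?_, ?_⟩
      · simpa using hT'.1
      · simpa using hT'.2
    · intro T _ T' _ h
      have h' := Prod.ext_iff.1 h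
      simp only at h'
      have h'' : grow Y T m ∪ T \ grow Y T m = grow Y T' m ∪ T' \ grow Y T' m :=
        congrArg₂ (· ∪ ·) h'.1 h'.2
      rwa [Finset.union_sdiff_of_subset (grow_subset m),
        Finset.union_sdiff_of_subset (grow_subset m)] at h''
  rw [Finset.card_product] at h4
  have h5 : ((Finset.univ.filter fun T : Finset ι =>
      T.card = t ∧ ((T \ grow Y T m).card : ℝ) ≤ r).card : ℝ) ≤
      𝒲.card * (Finset.univ.filter fun U : Finset ι => (U.card : ℝ) ≤ r).card := by
    exact_mod_cast h4
  exact h5.trans (mul_le_mul h1 (card_filter_card_le ht htp r) (by positivity) (by positivity))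

end grow

/-! ### The quantities of the linear model -/

section model

variable {n p : ℕ} {X : Matrix (Fin n) (Fin p) ℝ} {β : Fin p → ℝ}

lemma observe_eq (w : Fin n → ℝ) :
    observe X β w = ∑ i ∈ supp β, β i • column X i + WithLp.toLp 2 w := by
  have h : ∑ i ∈ supp β, β i • column X i = ∑ i, β i • column X i := by
    refine Finset.sum_subset (Finset.subset_univ _) fun i _ hi => ?_
    have : β i = 0 := by simpa [supp] using hi
    rw [this, zero_smul]
  rw [h]
  ext i
  simp [observe, column, Matrix.mulVec, dotProduct, mul_comm]

lemma betaMin_le {j : Fin p} (hj : j ∈ supp β) : betaMin β ≤ |β j| :=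
  csInf_le ⟨0, by rintro _ ⟨i, _, rfl⟩; exact abs_nonneg _⟩ ⟨j, hj, rfl⟩

lemma betaMin_pos (h : (supp β).Nonempty) : 0 < betaMin β := by
  have hne : ((fun j => |β j|) '' (supp β : Set (Fin p))).Nonempty := by
    simpa using h
  obtain ⟨j, hj, hj'⟩ := hne.csInf_mem ((supp β).finite_toSet.image _)
  rw [betaMin, ← hj']
  exact abs_pos.2 (by simpa [supp] using hj)

lemma mulColumns_eq (A : Finset (Fin p)) (a : Fin p → ℝ) :
    mulColumns X A (WithLp.toLp 2 fun j => a j) = ∑ j ∈ A, a j • column X j := by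
  rw [mulColumns, ← Finset.sum_coe_sort A]

lemma wellConditioned_column {S A : Finset (Fin p)} {m : ℕ} (hn : 0 < n) (hm : m ≤ p)
    (hSA : S ⊆ A) (hA : A.card ≤ m) :
    WellConditioned (column X) A (n * restrictedEigenvalue X S m) := by
  obtain ⟨A', hAA', hA'⟩ := Finset.exists_superset_card_eq hA (by simpa using hm)
  refine WellConditioned.mono (A := A') (fun a => ?_) hAA'
  set v : EuclideanSpace ℝ A' := WithLp.toLp 2 fun j => a j with hv
  have hvn : ‖v‖ ^ 2 = ∑ j ∈ A', a j ^ 2 := by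
    rw [EuclideanSpace.real_norm_sq_eq, ← Finset.sum_coe_sort A']
  rw [← mulColumns_eq, ← hvn, ← hv]
  rcases eq_or_ne v 0 with h0 | h0
  · rw [h0, norm_zero]; simp
  have hpos : 0 < (n : ℝ) * ‖v‖ ^ 2 := by
    have : 0 < ‖v‖ := norm_pos_iff.2 h0
    positivity
  have hle : restrictedEigenvalue X S m ≤ ‖mulColumns X A' v‖ ^ 2 / (n * ‖v‖ ^ 2) := by
    refine csInf_le ⟨0, ?_⟩ ⟨A', hSA.trans hAA', hA', v, h0, rfl⟩
    rintro _ ⟨_, _, _, _, _, rfl⟩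
    positivity
  rw [le_div_iff₀ hpos] at hle
  linarith

lemma WellConditioned.le_norm_sq {ι E : Type*} [NormedAddCommGroup E] [InnerProductSpace ℝ E]
    {x : ι → E} {A : Finset ι} {N : ℝ} (h : WellConditioned x A N) {j : ι} (hj : j ∈ A) :
    N ≤ ‖x j‖ ^ 2 := by
  have := h.mono (Finset.singleton_subset_iff.2 hj) (fun _ => 1)
  simpa using this

lemma sub_loss_insert_le_maxDecrease {S : Finset (Fin p)} (y : EuclideanSpace ℝ (Fin n))
    {j : Fin p} (hj : j ∉ S) : loss X y S - loss X y (insert j S) ≤ maxDecrease X y S :=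
  le_ciSup (f := fun j : {j : Fin p // j ∉ S} => loss X y S - loss X y (insert j.1 S))
    (Set.finite_range _).bddAbove ⟨j, hj⟩

lemma maxDecrease_lt {S : Finset (Fin p)} {y : EuclideanSpace ℝ (Fin n)} {a : ℝ}
    (hne : ∃ j, j ∉ S) (h : ∀ j ∉ S, loss X y S - loss X y (insert j S) < a) :
    maxDecrease X y S < a := by
  obtain ⟨j, hj⟩ := hne
  have : Nonempty {j : Fin p // j ∉ S} := ⟨⟨j, hj⟩⟩
  obtain ⟨i, hi⟩ := exists_eq_ciSup_of_finite
    (f := fun j : {j : Fin p // j ∉ S} => loss X y S - loss X y (insert j.1 S))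
  rw [maxDecrease, ← hi]
  exact h i.1 i.2

open Classical in
/-- The search returns the support if it stops at the true sparsity level, but not earlier. -/
lemma path_eq_some {alg : Algorithm n p} {y : EuclideanSpace ℝ (Fin n)} {c : ℝ} {k : ℕ}
    {S : Finset (Fin p)} (hk : k ≤ min n p) (hS : alg.run y X k = S)
    (hend : maxDecrease X y S < 2 * c * sigmaHatSq X y S * Real.log p)
    (hgo : ∀ S' : Finset (Fin p), S'.card < k →
      ¬ maxDecrease X y S' < 2 * c * sigmaHatSq X y S' * Real.log p) :
    path alg y X c = some S := by
  rw [path, Option.map_eq_some_iff]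
  refine ⟨k, ?_, hS⟩
  rw [List.find?_range_eq_some]
  refine ⟨by rw [hS]; simpa using hend, by simpa [Nat.lt_succ_iff] using hk, fun s hs => ?_⟩
  have := hgo (alg.run y X s) (by rw [alg.card_run _ _ _ (hs.le.trans hk)]; exact hs)
  simpa using this

end model

/-! ### Consequences of the sample size -/

section numeric

/-- The constants in the sample size are chosen such that a level below the true one can only be
accepted if the correlations of the residual with all missed columns are at most `N b / 2`. -/
lemma sqrt_two_mul_loss_div_le {n k L σ b ρ Q : ℝ} (hk : 1 ≤ k) (hL : 0 < L) (hσ : 0 < σ)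
    (hb : 0 < b) (hρ : 0 < ρ) (hρ1 : ρ ≤ 1) (hn : 0 < n)
    (hsize : 2 * k * L / ρ + 8 * σ * √k * L / (b * ρ ^ 2) + 8 * σ ^ 2 * L / (b ^ 2 * ρ ^ 2) ≤ n)
    (hQ : Q ≤ k * (2 * L * Q) / (n * ρ) + (σ * (√n + √(2 * L))) ^ 2) :
    √(2 * L * Q) / (n * ρ) ≤ b / 2 := by
  have hN : 0 < n * ρ := by positivity
  set a := √k with ha
  have ha2 : a ^ 2 = k := Real.sq_sqrt (by linarith)
  have ha1 : 1 ≤ a := Real.one_le_sqrt.2 hk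
  set m := √n with hm
  have hm2 : m ^ 2 = n := Real.sq_sqrt hn.le
  have hm0 : 0 < m := Real.sqrt_pos.2 hn
  set l := √(2 * L) with hl
  have hl2 : l ^ 2 = 2 * L := Real.sq_sqrt (by linarith)
  have hl0 : 0 < l := Real.sqrt_pos.2 (by linarith)
  set D := 8 * L * (a * σ * b + σ ^ 2) / b ^ 2 with hD
  have hD0 : 0 < D := by positivity
  have h1 : 2 * k * L + D / ρ ≤ n * ρ := by
    have := mul_le_mul_of_nonneg_right hsize hρ.le
    refine le_trans (le_of_eq ?_) this
    rw [hD]; field_simp; ring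
  have hDn : 2 * k * L + D ≤ n := by
    have h2 : D ≤ D / ρ := le_div_self hD0.le hρ hρ1
    have h3 : n * ρ ≤ n := by nlinarith
    linarith
  -- completing the square in the lower bound for the sample size
  have hbm : l * (b * a + 2 * σ) ≤ b * m := by
    refine abs_le_of_sq_le_sq' ?_ (by positivity) |>.2
    have : (l * (b * a + 2 * σ)) ^ 2 = b ^ 2 * (2 * k * L + D) := by
      rw [mul_pow, hl2, ← ha2, hD]; field_simp; ring
    rw [this, mul_pow, hm2]
    exact mul_le_mul_of_nonneg_left hDn (sq_nonneg b)
  have hkey : σ * (2 * l * m + l ^ 2) ≤ m ^ 2 * a * b := by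
    have e1 : m * a * (l * (b * a + 2 * σ)) ≤ m * a * (b * m) :=
      mul_le_mul_of_nonneg_left hbm (by positivity)
    have e2 : 2 * σ * l ≤ b * m := by
      have : 0 < l * b * a := by positivity
      linarith
    have e3 : m * l * σ * 1 ≤ m * l * σ * a := mul_le_mul_of_nonneg_left ha1 (by positivity)
    have e4 : l * (2 * σ * l) ≤ l * (b * m) := mul_le_mul_of_nonneg_left e2 hl0.le
    have e5 : l * b * m * 1 ≤ l * b * m * a ^ 2 :=
      mul_le_mul_of_nonneg_left (one_le_pow₀ ha1) (by positivity)
    have e6 : 0 ≤ σ * l ^ 2 := by positivity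
    linarith
  have hR : (σ * (m + l)) ^ 2 ≤ n * (a * σ * b + σ ^ 2) := by
    rw [← hm2]
    linarith [mul_le_mul_of_nonneg_left hkey hσ.le]
  rcases le_or_gt Q 0 with hQ0 | hQ0
  · rw [Real.sqrt_eq_zero_of_nonpos (mul_nonpos_of_nonneg_of_nonpos (by linarith) hQ0),
      zero_div]; positivity
  have h2 : Q * D ≤ n * ρ ^ 2 * (n * (a * σ * b + σ ^ 2)) := by
    have e1 : Q * (n * ρ) ≤ k * (2 * L * Q) + (σ * (m + l)) ^ 2 * (n * ρ) := by
      have := mul_le_mul_of_nonneg_right hQ hN.le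
      rwa [add_mul, div_mul_cancel₀ _ hN.ne'] at this
    have e2 : Q * (D / ρ) ≤ (σ * (m + l)) ^ 2 * (n * ρ) := by
      linarith [mul_le_mul_of_nonneg_left h1 hQ0.le]
    have e3 : Q * D = Q * (D / ρ) * ρ := by field_simp
    have e4 : (σ * (m + l)) ^ 2 * (n * ρ) ≤ n * (a * σ * b + σ ^ 2) * (n * ρ) :=
      mul_le_mul_of_nonneg_right hR hN.le
    rw [e3]
    refine (mul_le_mul_of_nonneg_right (e2.trans e4) hρ.le).trans_eq ?_
    ring
  rw [div_le_iff₀ hN]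
  refine Real.sqrt_le_iff.2 ⟨by positivity, ?_⟩
  have hG : 0 < a * σ * b + σ ^ 2 := by positivity
  have h3 : Q * (8 * L) ≤ (n * ρ) ^ 2 * b ^ 2 := by
    have e : Q * D = Q * (8 * L) / b ^ 2 * (a * σ * b + σ ^ 2) := by rw [hD]; ring
    rw [e] at h2
    have h4 : Q * (8 * L) / b ^ 2 ≤ (n * ρ) ^ 2 := by
      refine le_of_mul_le_mul_right (h2.trans_eq ?_) hG
      ring
    rwa [div_le_iff₀ (by positivity)] at h4
  linarith

lemma two_mul_mul_le_of_size {n k L σ b ρ : ℝ} (hL : 0 ≤ L) (hσ : 0 ≤ σ)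
    (hb : 0 < b) (hρ : 0 < ρ)
    (hsize : 2 * k * L / ρ + 8 * σ * √k * L / (b * ρ ^ 2) + 8 * σ ^ 2 * L / (b ^ 2 * ρ ^ 2) ≤ n) :
    2 * k * L ≤ n * ρ := by
  have h1 : 0 ≤ 8 * σ * √k * L / (b * ρ ^ 2) := by positivity
  have h2 : 0 ≤ 8 * σ ^ 2 * L / (b ^ 2 * ρ ^ 2) := by positivity
  have : 2 * k * L / ρ ≤ n := by linarith
  rwa [div_le_iff₀ hρ] at this

lemma sq_mul_lt_of_size {n k L σ b ρ : ℝ} (hk : 0 < k) (hL : 0 < L) (hσ : 0 ≤ σ)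
    (hb : 0 < b) (hρ : 0 < ρ) (hρ1 : ρ ≤ 1)
    (hsize : 2 * k * L / ρ + 8 * σ * √k * L / (b * ρ ^ 2) + 8 * σ ^ 2 * L / (b ^ 2 * ρ ^ 2) ≤ n) :
    8 * σ ^ 2 * L < b ^ 2 * (n * ρ) := by
  have h1 : 0 ≤ 8 * σ * √k * L / (b * ρ ^ 2) := by positivity
  have h2 : 0 < 2 * k * L / ρ := by positivity
  have h3 : 8 * σ ^ 2 * L / (b ^ 2 * ρ ^ 2) < n := by linarith
  rw [div_lt_iff₀ (by positivity)] at h3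
  have hn : 0 ≤ n := by
    have : 0 ≤ 8 * σ ^ 2 * L / (b ^ 2 * ρ ^ 2) := by positivity
    linarith
  have h4 : ρ ^ 2 ≤ ρ := by nlinarith
  have h5 : n * (b ^ 2 * ρ ^ 2) ≤ n * (b ^ 2 * ρ) := by gcongr
  linarith

end numeric

/-! ### No early stopping -/

section early

/-- The elements `j` of `S₀` which are noticeably affected by the set `F` of wrong variables, or
noticeably coupled to the set `W`. The thresholds are such that there are at most `2 t² / υ` of them
if `F` and `W` have at most `t` elements. -/
noncomputable def eligible {ι E : Type*} [DecidableEq ι] [NormedAddCommGroup E]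
    [InnerProductSpace ℝ E] [FiniteDimensional ℝ E] (x : ι → E) (S₀ F : Finset ι) (N υ : ℝ) (t : ℕ)
    (W : Finset ι) : Finset ι :=
  S₀.filter (fun j => υ < t * N * ‖dualVec x (S₀ ∪ F) j - dualVec x S₀ j‖ ^ 2) ∪
    S₀.filter (fun j => υ < t * N ^ 2 *
      ∑ i ∈ W ∩ S₀, inner ℝ (dualVec x (S₀ ∪ F) i) (dualVec x (S₀ ∪ F) j) ^ 2)

lemma card_filter_lt_le {ι : Type*} (S : Finset ι) {f : ι → ℝ} (hf : ∀ i ∈ S, 0 ≤ f i) {υ a : ℝ}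
    (hυ : 0 < υ) (ha : ∑ i ∈ S, f i ≤ a) : ((S.filter fun i => υ < f i).card : ℝ) ≤ a / υ := by
  rw [le_div_iff₀ hυ, ← nsmul_eq_mul]
  refine (Finset.card_nsmul_le_sum _ f _ fun i hi => (Finset.mem_filter.1 hi).2.le).trans ?_
  exact (Finset.sum_le_sum_of_subset_of_nonneg (Finset.filter_subset _ _)
    fun i hi _ => hf i hi).trans ha

lemma card_eligible_le {ι E : Type*} [DecidableEq ι] [NormedAddCommGroup E]
    [InnerProductSpace ℝ E] [FiniteDimensional ℝ E] {x : ι → E} {S₀ F W : Finset ι} {N υ : ℝ}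
    {t : ℕ} (hN : 0 < N) (hυ : 0 < υ) (hA : WellConditioned x (S₀ ∪ F) N) (hF : F.card ≤ t)
    (hW : W.card ≤ t) : ((eligible x S₀ F N υ t W).card : ℝ) ≤ 2 * t ^ 2 / υ := by
  have hF' : (F.card : ℝ) ≤ t := by exact_mod_cast hF
  have ht0 : (0 : ℝ) ≤ t := Nat.cast_nonneg t
  have h1 : ((S₀.filter (fun j => υ <
      t * N * ‖dualVec x (S₀ ∪ F) j - dualVec x S₀ j‖ ^ 2)).card : ℝ) ≤ t ^ 2 / υ := by
    refine card_filter_lt_le _ (fun _ _ => by positivity) hυ ?_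
    have := sum_norm_dualVec_sub_sq_le hN hA
    rw [← Finset.mul_sum, mul_assoc, pow_two]
    exact mul_le_mul_of_nonneg_left (this.trans hF') ht0
  have h2 : ((S₀.filter (fun j => υ < t * N ^ 2 * ∑ i ∈ W ∩ S₀,
      inner ℝ (dualVec x (S₀ ∪ F) i) (dualVec x (S₀ ∪ F) j) ^ 2)).card : ℝ) ≤ t ^ 2 / υ := by
    refine card_filter_lt_le _ (fun _ _ => by positivity) hυ ?_
    rw [← Finset.mul_sum, Finset.sum_comm, pow_two, pow_two, mul_assoc, mul_assoc]
    refine mul_le_mul_of_nonneg_left ?_ ht0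
    rw [Finset.mul_sum, Finset.mul_sum]
    calc ∑ i ∈ W ∩ S₀, N * (N * ∑ j ∈ S₀,
          inner ℝ (dualVec x (S₀ ∪ F) i) (dualVec x (S₀ ∪ F) j) ^ 2)
        ≤ ∑ i ∈ W ∩ S₀, (1 : ℝ) := by
          refine Finset.sum_le_sum fun i hi => ?_
          have hi' : i ∈ S₀ ∪ F := Finset.mem_union_left _ (Finset.mem_inter.1 hi).2
          have h3 := sum_inner_dualVec_sq_le hN hA Finset.subset_union_left
            (dualVec x (S₀ ∪ F) i)
          have h4 := norm_dualVec_sq_le hN hA hi'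
          rw [le_div_iff₀ hN] at h4
          simp_rw [real_inner_comm] at h3 ⊢
          nlinarith
      _ ≤ t := by
          simp only [Finset.sum_const, nsmul_eq_mul, mul_one]
          exact_mod_cast (Finset.card_le_card Finset.inter_subset_left).trans hW
  have h3 : ((eligible x S₀ F N υ t W).card : ℝ) ≤
      (S₀.filter (fun j => υ < t * N * ‖dualVec x (S₀ ∪ F) j - dualVec x S₀ j‖ ^ 2)).card +
      (S₀.filter (fun j => υ < t * N ^ 2 * ∑ i ∈ W ∩ S₀,
        inner ℝ (dualVec x (S₀ ∪ F) i) (dualVec x (S₀ ∪ F) j) ^ 2)).card := by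
    exact_mod_cast Finset.card_union_le _ _
  refine h3.trans ((add_le_add h1 h2).trans_eq ?_)
  ring

/-- The noise in the estimate of a coefficient which is hardly affected by the wrong variables: it
is close to the noise for the true support, which is below the bound for a single Gaussian. -/
lemma abs_inner_dualVec_le {ι E : Type*} [DecidableEq ι] [NormedAddCommGroup E]
    [InnerProductSpace ℝ E] [FiniteDimensional ℝ E] {x : ι → E} {S₀ F : Finset ι} {N ε L : ℝ}
    {t : ℕ} {g : E} (hN : 0 < N) (hε : 0 < ε) (hε1 : ε < 1) (hL : 0 < L) (ht : 0 < t)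
    (hA : WellConditioned x (S₀ ∪ F) N) {j : ι} (hj : j ∈ S₀)
    (hg : inner ℝ (dualVec x S₀ j) g ^ 2 ≤ 2 * L * (1 - ε / 2) * (1 / N))
    (hgV : ‖(newDirections x S₀ F).starProjection g‖ ^ 2 ≤ 4 * t * L)
    (hz : t * N * ‖dualVec x (S₀ ∪ F) j - dualVec x S₀ j‖ ^ 2 ≤ (ε / 16) ^ 2) :
    |inner ℝ (dualVec x (S₀ ∪ F) j) g| ≤ √(2 * L / N) * (1 - ε / 4 + 3 / 2 * (ε / 16)) := by
  have ht0 : (0 : ℝ) < t := by exact_mod_cast ht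
  have hzV := dualVec_sub_mem_newDirections hN hA hj
  have hd : inner ℝ (dualVec x (S₀ ∪ F) j) g = inner ℝ (dualVec x S₀ j) g +
      inner ℝ (dualVec x (S₀ ∪ F) j - dualVec x S₀ j) g := by
    rw [inner_sub_left, add_sub_cancel]
  generalize dualVec x (S₀ ∪ F) j - dualVec x S₀ j = z at hz hzV hd
  obtain ⟨h, hh⟩ : ∃ h, h = √(2 * L / N) := ⟨_, rfl⟩
  have hh2 : h ^ 2 = 2 * L / N := by rw [hh]; exact Real.sq_sqrt (by positivity)
  have hh0 : 0 < h := by rw [hh]; exact Real.sqrt_pos.2 (by positivity)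
  have h1 : |inner ℝ (dualVec x S₀ j) g| ≤ h * (1 - ε / 4) := by
    refine abs_le_of_sq_le_sq ?_ (mul_nonneg hh0.le (by linarith))
    refine hg.trans ?_
    rw [mul_pow, hh2, show 2 * L * (1 - ε / 2) * (1 / N) = 2 * L / N * (1 - ε / 2) by ring]
    refine mul_le_mul_of_nonneg_left ?_ (by positivity)
    linarith [sq_nonneg ε, show (1 - ε / 4) ^ 2 = 1 - ε / 2 + ε ^ 2 / 16 by ring]
  have h2 : |inner ℝ z g| ≤ h * (3 / 2 * (ε / 16)) := by
    refine abs_le_of_sq_le_sq ?_ (by positivity)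
    have h3 : inner ℝ z g = inner ℝ z ((newDirections x S₀ F).starProjection g) := by
      rw [← Submodule.inner_starProjection_left_eq_right,
        Submodule.starProjection_eq_self_iff.2 hzV]
    have h4 : inner ℝ z g ^ 2 ≤
        ‖z‖ ^ 2 * ‖(newDirections x S₀ F).starProjection g‖ ^ 2 := by
      rw [h3, ← mul_pow, ← sq_abs]
      exact pow_le_pow_left₀ (abs_nonneg _) (abs_real_inner_le_norm _ _) 2
    have h5 : ‖z‖ ^ 2 ≤ (ε / 16) ^ 2 / (t * N) := by
      rw [le_div_iff₀ (by positivity), mul_comm]; exact hz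
    refine h4.trans ((mul_le_mul h5 hgV (sq_nonneg _) (by positivity)).trans ?_)
    rw [mul_pow, hh2, show (ε / 16) ^ 2 / (t * N) * (4 * t * L) = 2 * L / N * (2 * (ε / 16) ^ 2) by
      field_simp; ring]
    refine mul_le_mul_of_nonneg_left ?_ (by positivity)
    linarith [sq_nonneg ε]
  rw [hd, ← hh, mul_add]
  exact (abs_add_le _ _).trans (add_le_add h1 h2)

/-- If the noise in the coefficients that are neither noticeably affected by `F` nor noticeably
coupled to the ones found so far is small, then each step finds a fixed proportion of what is left
of `T`. -/
lemma mul_card_sdiff_grow_le {ι E : Type*} [DecidableEq ι] [NormedAddCommGroup E]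
    [InnerProductSpace ℝ E] [FiniteDimensional ℝ E] {x : ι → E} {S₀ F T : Finset ι}
    {N ε σ h b Ξ : ℝ} {w : E} {β ξ : ι → ℝ} (hN : 0 < N) (hε : 0 < ε) (hε1 : ε < 1) (hb : 0 < b)
    (hA : WellConditioned x (S₀ ∪ F) N) (hT : T ⊆ S₀) (hΞ : 0 ≤ Ξ) (hΞN : Ξ / N ≤ b / 2)
    (hσh : σ * h ≤ b / 2) (hξ : ∀ i ∈ T, |ξ i| ≤ Ξ) (hβ : ∀ j ∈ T, b ≤ |β j|)
    (heq : ∀ j ∈ T, β j + inner ℝ (dualVec x (S₀ ∪ F) j) w =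
      ∑ i ∈ T, inner ℝ (dualVec x (S₀ ∪ F) i) (dualVec x (S₀ ∪ F) j) * ξ i)
    (hη : ∀ j ∈ T, T.card * N * ‖dualVec x (S₀ ∪ F) j - dualVec x S₀ j‖ ^ 2 ≤ (ε / 16) ^ 2 →
      |inner ℝ (dualVec x (S₀ ∪ F) j) w| ≤ σ * (h * (1 - ε / 4 + 3 / 2 * (ε / 16)))) (m : ℕ) :
    (ε / 16) ^ 2 * (T \ grow (eligible x S₀ F N ((ε / 16) ^ 2) T.card) T (m + 1)).card ≤
      ((grow (eligible x S₀ F N ((ε / 16) ^ 2) T.card) T (m + 1) \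
        grow (eligible x S₀ F N ((ε / 16) ^ 2) T.card) T m).card : ℝ) := by
  have hsub : grow (eligible x S₀ F N ((ε / 16) ^ 2) T.card) T m ⊆
    grow (eligible x S₀ F N ((ε / 16) ^ 2) T.card) T (m + 1) := Finset.subset_union_left
  have hnotY : ∀ j ∈ T \ grow (eligible x S₀ F N ((ε / 16) ^ 2) T.card) T (m + 1),
      j ∉ eligible x S₀ F N ((ε / 16) ^ 2) T.card
        (grow (eligible x S₀ F N ((ε / 16) ^ 2) T.card) T m) := by
    intro j hj hjY
    have hj' := Finset.mem_sdiff.1 hj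
    exact hj'.2 (Finset.mem_union_right _ (Finset.mem_inter.2 ⟨hj'.1, hjY⟩))
  have hW' : grow (eligible x S₀ F N ((ε / 16) ^ 2) T.card) T (m + 1) ⊆ T := grow_subset _
  generalize grow (eligible x S₀ F N ((ε / 16) ^ 2) T.card) T m = W at *
  generalize grow (eligible x S₀ F N ((ε / 16) ^ 2) T.card) T (m + 1) = W' at *
  have hz : ∀ j ∈ T \ W', |inner ℝ (dualVec x (S₀ ∪ F) j) w| ≤
      σ * (h * (1 - ε / 4 + 3 / 2 * (ε / 16))) := by
    intro j hj
    have hjT := (Finset.mem_sdiff.1 hj).1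
    refine hη j hjT ?_
    by_contra! hc
    exact hnotY j hj (Finset.mem_union_left _ (Finset.mem_filter.2 ⟨hT hjT, hc⟩))
  have hK : ∀ j ∈ T \ W', T.card * N ^ 2 * ∑ i ∈ W,
      inner ℝ (dualVec x (S₀ ∪ F) i) (dualVec x (S₀ ∪ F) j) ^ 2 ≤ (ε / 16) ^ 2 := by
    intro j hj
    have hjT := (Finset.mem_sdiff.1 hj).1
    by_contra! hc
    refine hnotY j hj (Finset.mem_union_right _ (Finset.mem_filter.2 ⟨hT hjT, ?_⟩))
    rwa [Finset.inter_eq_left.2 ((hsub.trans hW').trans hT)]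
  have hmain := card_sdiff_mul_le hN hA (hT.trans Finset.subset_union_left) hsub hW' hΞ
    (by positivity : 0 ≤ ε / 16) hξ hβ heq hz hK
  by_contra! hlt
  obtain ⟨u, hu⟩ : ∃ u : ℝ, u = (T \ W').card := ⟨_, rfl⟩
  obtain ⟨v, hv⟩ : ∃ v : ℝ, v = (W' \ W).card := ⟨_, rfl⟩
  rw [← hu, ← hv] at hlt hmain
  have hv0 : 0 ≤ v := by rw [hv]; exact Nat.cast_nonneg _
  have hu0 : 0 < u := pos_of_mul_pos_right (hv0.trans_lt hlt) (by positivity)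
  have hsqrt : √(u * v) ≤ ε / 16 * u := by
    refine Real.sqrt_le_iff.2 ⟨by positivity, ?_⟩
    rw [mul_pow, pow_two u, ← mul_assoc, mul_comm u v]
    exact mul_le_mul_of_nonneg_right hlt.le hu0.le
  -- since `σ h ≤ b / 2`, the left-hand side is at least `u (b / 2) (1 + 5 ε / 32)`
  have h6 : u * (b - σ * (h * (1 - ε / 4 + 3 / 2 * (ε / 16)))) ≤
      u * (b / 2 * (1 + 2 * (ε / 16))) := by
    refine hmain.trans ?_
    calc Ξ / N * (u + √(u * v) + ε / 16 * u)
        ≤ b / 2 * (u + ε / 16 * u + ε / 16 * u) := by gcongr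
      _ = _ := by ring
  have h7 := le_of_mul_le_mul_left h6 hu0
  have h8 : σ * h * (1 - ε / 4 + 3 / 2 * (ε / 16)) ≤ b / 2 * (1 - ε / 4 + 3 / 2 * (ε / 16)) :=
    mul_le_mul_of_nonneg_right hσh (by linarith)
  linarith [mul_pos hb hε]

variable {n p : ℕ} {X : Matrix (Fin n) (Fin p) ℝ} {S S₀ : Finset (Fin p)} {β : Fin p → ℝ}

/-- If the noise behaves, then PaTh does not stop at a set `S` with fewer elements than the
support. -/
lemma exists_le_loss_sub_of_card_lt {ε L σ b N : ℝ} {M : ℕ} {g : EuclideanSpace ℝ (Fin n)}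
    (hε : 0 < ε) (hε1 : ε < 1) (hL : 0 < L) (hσ : 0 < σ) (hb : 0 < b) (hN : 0 < N) (hn : 0 < n)
    (hM : 2 / ε ≤ (1 + (ε / 16) ^ 2) ^ M)
    (hcol : ∀ j, ‖column X j‖ ^ 2 = n)
    (hA : ∀ F : Finset (Fin p), F.card ≤ S₀.card → WellConditioned (column X) (S₀ ∪ F) N)
    (hβ : ∀ j ∈ S₀, b ≤ |β j|)
    (hΞ : ∀ Q : ℝ, Q ≤ S₀.card * (2 * L * Q) / N + (σ * (√n + √(2 * L))) ^ 2 →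
      √(2 * L * Q) / N ≤ b / 2)
    (hbN : 8 * σ ^ 2 * L < b ^ 2 * N)
    (hgR : ‖g‖ < √n + √(2 * L))
    (hgM : ∀ j ∈ S₀, inner ℝ (dualVec (column X) S₀ j) g ^ 2 ≤ 2 * L * (1 - ε / 2) * (1 / N))
    (hgV : ∀ t ∈ Finset.Icc 1 S₀.card, ∀ F : Finset (Fin p), F.card ≤ t →
      ‖(newDirections (column X) S₀ F).starProjection g‖ ^ 2 < 4 * t * L)
    (hgU : ∀ t ∈ Finset.Icc 1 S₀.card, ∀ F : Finset (Fin p), F.card ≤ t → ∀ T ⊆ S₀, T.card = t →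
      ((T \ grow (eligible (column X) S₀ F N ((ε / 16) ^ 2) t) T M).card : ℝ) ≤ ε / 2 * t →
      inner ℝ (signedDual (column X) (S₀ ∪ F) β T) g ^ 2 ≤ 2 * L * t * (t / N))
    (hS : S.card < S₀.card) :
    ∃ j ∉ S, 2 * L * loss X (∑ i ∈ S₀, β i • column X i + σ • g) S / n ≤
      loss X (∑ i ∈ S₀, β i • column X i + σ • g) S -
        loss X (∑ i ∈ S₀, β i • column X i + σ • g) (insert j S) := by
  by_contra! hend
  have hFT : (S \ S₀).card < (S₀ \ S).card := by
    have h1 := Finset.card_sdiff_add_card_inter S S₀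
    have h2 := Finset.card_sdiff_add_card_inter S₀ S
    rw [Finset.inter_comm] at h2
    omega
  set x := column X with hx
  set y := ∑ i ∈ S₀, β i • x i + σ • g with hy
  set Q := loss X y S with hQ
  set T := S₀ \ S with hT
  set F := S \ S₀ with hF
  have hn' : (0 : ℝ) < n := by exact_mod_cast hn
  set t := T.card with ht
  have htS : t ≤ S₀.card := Finset.card_le_card Finset.sdiff_subset
  have htI : t ∈ Finset.Icc 1 S₀.card := Finset.mem_Icc.2 ⟨by omega, htS⟩
  have ht0 : (0 : ℝ) < t := by exact_mod_cast (by omega : 0 < t)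
  have hAF := hA F (by omega)
  have hTS : T ⊆ S₀ := Finset.sdiff_subset
  have hTA : T ⊆ S₀ ∪ F := hTS.trans Finset.subset_union_left
  have hQ0 : 0 ≤ Q := by rw [hQ, loss]; positivity
  set ξ : Fin p → ℝ := fun i => inner ℝ (x i) (residual X S y) with hξdef
  set Ξ := √(2 * L * Q) with hΞdef
  have hξ2 : ∀ i ∈ T, ξ i ^ 2 ≤ 2 * L * Q := by
    intro i hi
    have h1 := sq_inner_residual_le (X := X) (S := S) y i
    rw [hcol] at h1
    have h2 := hend i (Finset.mem_sdiff.1 hi).2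
    rw [lt_div_iff₀ hn'] at h2
    linarith
  have hξ : ∀ i ∈ T, |ξ i| ≤ Ξ := fun i hi => Real.abs_le_sqrt (hξ2 i hi)
  have hΞ0 : 0 ≤ Ξ := Real.sqrt_nonneg _
  have heq : ∀ j ∈ T, β j + inner ℝ (dualVec x (S₀ ∪ F) j) (σ • g) =
      ∑ i ∈ T, inner ℝ (dualVec x (S₀ ∪ F) i) (dualVec x (S₀ ∪ F) j) * ξ i :=
    fun j hj => add_inner_dualVec_eq_sum hN hAF (σ • g) hj
  have hΞN : Ξ / N ≤ b / 2 := by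
    refine hΞ Q ((loss_le_sum_add hN hAF (σ • g)).trans (add_le_add ?_ ?_))
    · refine div_le_div_of_nonneg_right ?_ hN.le
      refine (Finset.sum_le_card_nsmul _ _ _ hξ2).trans ?_
      rw [nsmul_eq_mul]
      exact mul_le_mul_of_nonneg_right (by exact_mod_cast htS) (by positivity)
    · rw [norm_smul, Real.norm_of_nonneg hσ.le]
      exact pow_le_pow_left₀ (by positivity) (mul_le_mul_of_nonneg_left hgR.le hσ.le) 2
  -- `σ / √N` bounds the standard deviations of the coefficient estimates, and `√(2L)` times this is
  -- less than `b / 2`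
  set h := √(2 * L / N) with hh
  have hh2 : h ^ 2 = 2 * L / N := Real.sq_sqrt (by positivity)
  have hh0 : 0 < h := Real.sqrt_pos.2 (by positivity)
  have hσh : σ * h < b / 2 := by
    refine abs_lt_of_sq_lt_sq' ?_ (by positivity) |>.2
    rw [mul_pow, hh2, mul_div_assoc', div_lt_iff₀ hN]
    linarith
  have hβT : ∀ j ∈ T, b ≤ |β j| := fun j hj => hβ j (hTS hj)
  have hη : ∀ j ∈ T, t * N * ‖dualVec x (S₀ ∪ F) j - dualVec x S₀ j‖ ^ 2 ≤ (ε / 16) ^ 2 →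
      |inner ℝ (dualVec x (S₀ ∪ F) j) (σ • g)| ≤ σ * (h * (1 - ε / 4 + 3 / 2 * (ε / 16))) := by
    intro j hj hz
    rw [real_inner_smul_right, abs_mul, abs_of_pos hσ]
    exact mul_le_mul_of_nonneg_left (abs_inner_dualVec_le hN hε hε1 hL (by omega) hAF (hTS hj)
      (hgM j (hTS hj)) (hgV t htI F hFT.le).le hz) hσ.le
  have hgrow := mul_card_sdiff_grow_le hN hε hε1 hb hAF hTS hΞ0 hΞN hσh.le hξ hβT heq hη
  have hpow := pow_mul_card_sdiff_grow_le (sq_nonneg (ε / 16)) hgrow M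
  have hsmall : ((T \ grow (eligible x S₀ F N ((ε / 16) ^ 2) t) T M).card : ℝ) ≤ ε / 2 * t := by
    have h1 := (mul_le_mul_of_nonneg_right hM (Nat.cast_nonneg _)).trans hpow
    rw [div_mul_eq_mul_div, div_le_iff₀ hε] at h1
    linarith
  have hU := hgU t htI F hFT.le T hTS rfl hsmall
  have h1 := card_mul_le_abs_inner_signedDual hN hAF hTA hΞ0 hξ hβT heq
  have h2 : |inner ℝ (signedDual x (S₀ ∪ F) β T) (σ • g)| ≤ σ * (h * t) := by
    rw [real_inner_smul_right, abs_mul, abs_of_pos hσ]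
    refine mul_le_mul_of_nonneg_left (abs_le_of_sq_le_sq (hU.trans_eq ?_) (by positivity)) hσ.le
    rw [mul_pow, hh2]; ring
  have h3 : t * (b / 2) ≤ t * (σ * h) := by
    have h4 : (t : ℝ) * (b / 2) ≤ t * (b - Ξ / N) := by gcongr; linarith
    linarith [h4.trans (h1.trans h2)]
  exact absurd (le_of_mul_le_mul_left h3 ht0) (not_le.2 hσh)

end early

/-! ### Union bounds -/

section union

lemma measureReal_biUnion_le_card_mul {α β : Type*} [MeasurableSpace α] {μ : Measure α}
    (s : Finset β) {f : β → Set α} {c : ℝ} (h : ∀ b ∈ s, μ.real (f b) ≤ c) :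
    μ.real (⋃ b ∈ s, f b) ≤ s.card * c :=
  (measureReal_biUnion_finset_le s f).trans
    ((Finset.sum_le_card_nsmul s _ c h).trans_eq (nsmul_eq_mul _ _))

lemma sum_pow_le_two_mul {z : ℝ} (hz : 0 ≤ z) (hz2 : z ≤ 1 / 2) (k : ℕ) :
    ∑ t ∈ Finset.Icc 1 k, z ^ t ≤ 2 * z := by
  have h : ∑ t ∈ Finset.Icc 1 k, z ^ t ≤ 2 * z - 2 * z ^ (k + 1) := by
    induction k with
    | zero => simp
    | succ k ih =>
      rw [Finset.sum_Icc_succ_top (by omega)]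
      have : z ^ (k + 2) ≤ z ^ (k + 1) * (1 / 2) := by
        rw [pow_succ]; exact mul_le_mul_of_nonneg_left hz2 (by positivity)
      rw [show k + 1 + 1 = k + 2 by ring]
      linarith
  linarith [pow_nonneg hz (k + 1)]

/-- With `D = δ^(-1/2)`, this turns the factor `δ^(-t/2)` of a tail bound into `D^t`. -/
lemma rpow_neg_half_mul {δ : ℝ} (hδ : 0 ≤ δ) (t : ℕ) :
    δ ^ (-(t / 2 : ℝ)) = (δ ^ (-(1 / 2 : ℝ))) ^ t := by
  rw [← Real.rpow_natCast, ← Real.rpow_mul hδ]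
  congr 1; ring

lemma one_le_rpow_neg_half {δ : ℝ} (hδ : 0 < δ) (hδ1 : δ ≤ 1) : 1 ≤ δ ^ (-(1 / 2 : ℝ)) :=
  Real.one_le_rpow_of_pos_of_le_one_of_nonpos hδ hδ1 (by norm_num)

variable {ι E : Type*} [DecidableEq ι] [Fintype ι] [NormedAddCommGroup E] [InnerProductSpace ℝ E]
  [FiniteDimensional ℝ E] [MeasurableSpace E] [BorelSpace E]

lemma card_filter_card_le_nat {ι : Type*} [Fintype ι] {t : ℕ} (ht : 0 < t)
    (htp : t ≤ Fintype.card ι) :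
    ((Finset.univ.filter fun U : Finset ι => U.card ≤ t).card : ℝ) ≤
      Real.exp t * ((Fintype.card ι : ℝ) / t) ^ t := by
  have := card_filter_card_le ht htp t
  rw [Real.rpow_natCast] at this
  simpa only [Nat.cast_le] using this

lemma stdGaussian_iUnion_newDirections_le {ι : Type*} [Fintype ι] (x : ι → E) (S : Finset ι)
    {ε L : ℝ} (hε : 0 < ε) (hε1 : ε < 1) (hL : 0 ≤ L) {t : ℕ} (ht : 0 < t)
    (htp : t ≤ Fintype.card ι) :
    (stdGaussian E).real (⋃ F ∈ Finset.univ.filter fun F : Finset ι => F.card ≤ t,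
      {g | 4 * t * L ≤ ‖(newDirections x S F).starProjection g‖ ^ 2}) ≤
    ((ε / 2) ^ (-(1 / 2 : ℝ)) * Real.exp 1 *
      (Fintype.card ι * Real.exp (-((1 - ε) * L)))) ^ t := by
  have ht1 : (1 : ℝ) ≤ t := by exact_mod_cast ht
  have ht0 : (0 : ℝ) < t := by linarith
  refine (measureReal_biUnion_le_card_mul _ fun F hF => stdGaussian_norm_starProjection_tail _
    ((finrank_newDirections_le S F).trans (Finset.mem_filter.1 hF).2) (by linarith : 0 < ε / 2)
    (by linarith) (4 * t * L)).trans ?_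
  rw [rpow_neg_half_mul (by linarith)]
  have hD : 0 ≤ (ε / 2) ^ (-(1 / 2 : ℝ)) := by positivity
  generalize (ε / 2) ^ (-(1 / 2 : ℝ)) = D at hD ⊢
  refine (mul_le_mul_of_nonneg_right (card_filter_card_le_nat ht htp) (by positivity)).trans ?_
  have h1 : ((Fintype.card ι : ℝ) / t) ^ t ≤ (Fintype.card ι : ℝ) ^ t := by
    refine pow_le_pow_left₀ (by positivity) (div_le_self (by positivity) ht1) t
  have h2 : Real.exp (-((1 - ε / 2) / 2 * (4 * t * L))) ≤ Real.exp (-((1 - ε) * L)) ^ t := by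
    rw [← Real.exp_nat_mul, Real.exp_le_exp]
    have : 0 ≤ t * L := by positivity
    linarith
  have h3 : Real.exp (t : ℝ) = Real.exp 1 ^ t := by rw [← Real.exp_nat_mul, mul_one]
  rw [h3]
  calc Real.exp 1 ^ t * ((Fintype.card ι : ℝ) / t) ^ t *
        (D ^ t * Real.exp (-((1 - ε / 2) / 2 * (4 * t * L))))
      ≤ Real.exp 1 ^ t * (Fintype.card ι : ℝ) ^ t *
        (D ^ t * Real.exp (-((1 - ε) * L)) ^ t) := by gcongr
    _ = _ := by rw [mul_pow, mul_pow, mul_pow]; ring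

/-- The union bound over the sign sums for the possible sets `T` of missed variables and `F` of
wrong variables. The number of relevant pairs is only slightly larger than `p^t`, although there
are about `p^(2t)` pairs of sets of size `t`. -/
lemma stdGaussian_iUnion_signedDual_le {x : ι → E} {S : Finset ι} {β : ι → ℝ} {N ε L : ℝ}
    (hN : 0 < N) (hε : 0 < ε) (hε1 : ε < 1) (hL : 0 < L)
    (hpL : (Fintype.card ι : ℝ) ≤ Real.exp L) {t : ℕ} (ht : 0 < t) (htp : t ≤ Fintype.card ι)
    (hA : ∀ F : Finset ι, F.card ≤ t → WellConditioned x (S ∪ F) N) (M : ℕ) :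
    (stdGaussian E).real (⋃ F ∈ Finset.univ.filter fun F : Finset ι => F.card ≤ t,
      ⋃ T ∈ Finset.univ.filter fun T : Finset ι => T ⊆ S ∧ T.card = t ∧
        ((T \ grow (eligible x S F N ((ε / 16) ^ 2) t) T M).card : ℝ) ≤ ε / 2 * t,
      {g | 2 * L * t * (t / N) < inner ℝ (signedDual x (S ∪ F) β T) g ^ 2}) ≤
    ((ε / 2) ^ (-(1 / 2 : ℝ)) * Real.exp (2 + 2 * M / (ε / 16) ^ 2) *
      (Fintype.card ι * Real.exp (-((1 - ε) * L)))) ^ t := by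
  have ht1 : (1 : ℝ) ≤ t := by exact_mod_cast ht
  have ht0 : (0 : ℝ) < t := by linarith
  have hp0 : (0 : ℝ) < Fintype.card ι := by exact_mod_cast ht.trans_le htp
  have hD : 1 ≤ (ε / 2) ^ (-(1 / 2 : ℝ)) := one_le_rpow_neg_half (by linarith) (by linarith)
  have hcount : ∀ F : Finset ι, F.card ≤ t →
      ((Finset.univ.filter fun T : Finset ι => T ⊆ S ∧ T.card = t ∧
        ((T \ grow (eligible x S F N ((ε / 16) ^ 2) t) T M).card : ℝ) ≤ ε / 2 * t).card : ℝ) ≤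
      (t : ℝ) ^ t * Real.exp (M * (2 * t ^ 2 / (ε / 16) ^ 2 / t)) *
        (Real.exp t * Real.exp (L * (ε / 2 * t))) := by
    intro F hF
    have hsub : (Finset.univ.filter fun T : Finset ι => T ⊆ S ∧ T.card = t ∧
        ((T \ grow (eligible x S F N ((ε / 16) ^ 2) t) T M).card : ℝ) ≤ ε / 2 * t) ⊆
        Finset.univ.filter fun T : Finset ι => T.card = t ∧
        ((T \ grow (eligible x S F N ((ε / 16) ^ 2) t) T M).card : ℝ) ≤ ε / 2 * t :=
      Finset.monotone_filter_right _ fun T _ h => h.2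
    refine (Nat.cast_le.2 (Finset.card_le_card hsub)).trans
      ((card_filter_grow_le ht htp (fun W hW =>
        card_eligible_le hN (by positivity) (hA F hF) hF hW) M).trans ?_)
    gcongr
    rw [Real.exp_mul]
    refine Real.rpow_le_rpow (by positivity) ((div_le_self hp0.le ht1).trans hpL) (by positivity)
  have hinner : ∀ F ∈ Finset.univ.filter fun F : Finset ι => F.card ≤ t,
      (stdGaussian E).real (⋃ T ∈ Finset.univ.filter fun T : Finset ι => T ⊆ S ∧ T.card = t ∧
        ((T \ grow (eligible x S F N ((ε / 16) ^ 2) t) T M).card : ℝ) ≤ ε / 2 * t,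
      {g | 2 * L * t * (t / N) < inner ℝ (signedDual x (S ∪ F) β T) g ^ 2}) ≤
      (t : ℝ) ^ t * Real.exp (M * (2 * t ^ 2 / (ε / 16) ^ 2 / t)) *
        (Real.exp t * Real.exp (L * (ε / 2 * t))) *
        ((ε / 2) ^ (-(1 / 2 : ℝ)) * Real.exp (-((1 - ε / 2) / 2 * (2 * L * t)))) := by
    intro F hF
    have hF' := (Finset.mem_filter.1 hF).2
    refine (measureReal_biUnion_le_card_mul _ fun T hT => ?_).trans
      (mul_le_mul_of_nonneg_right (hcount F hF') (by positivity))
    obtain ⟨hTS, hTt, -⟩ := (Finset.mem_filter.1 hT).2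
    refine stdGaussian_sq_inner_tail ?_ (by linarith) (by linarith) (by positivity)
    have := norm_signedDual_sq_le hN (hA F hF') (hTS.trans Finset.subset_union_left) β
    rwa [hTt] at this
  refine (measureReal_biUnion_le_card_mul _ hinner).trans
    ((mul_le_mul_of_nonneg_right (card_filter_card_le_nat ht htp) (by positivity)).trans ?_)
  generalize (ε / 2) ^ (-(1 / 2 : ℝ)) = D at hD ⊢
  have hDt : D ≤ D ^ t := le_self_pow₀ hD ht.ne'
  have hexp : Real.exp t * (Real.exp (M * (2 * t ^ 2 / (ε / 16) ^ 2 / t)) *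
      (Real.exp t * Real.exp (L * (ε / 2 * t))) * Real.exp (-((1 - ε / 2) / 2 * (2 * L * t)))) =
      Real.exp (2 + 2 * M / (ε / 16) ^ 2) ^ t * Real.exp (-((1 - ε) * L)) ^ t := by
    simp only [← Real.exp_nat_mul, ← Real.exp_add]
    congr 1
    field_simp
    ring
  calc Real.exp t * ((Fintype.card ι : ℝ) / t) ^ t *
        ((t : ℝ) ^ t * Real.exp (M * (2 * t ^ 2 / (ε / 16) ^ 2 / t)) *
        (Real.exp t * Real.exp (L * (ε / 2 * t))) *
        (D * Real.exp (-((1 - ε / 2) / 2 * (2 * L * t)))))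
      = D * ((Fintype.card ι : ℝ) / t * t) ^ t * (Real.exp t *
        (Real.exp (M * (2 * t ^ 2 / (ε / 16) ^ 2 / t)) *
        (Real.exp t * Real.exp (L * (ε / 2 * t))) *
          Real.exp (-((1 - ε / 2) / 2 * (2 * L * t))))) := by rw [mul_pow]; ring
    _ = D * (Fintype.card ι : ℝ) ^ t * (Real.exp (2 + 2 * M / (ε / 16) ^ 2) ^ t *
          Real.exp (-((1 - ε) * L)) ^ t) := by rw [hexp, div_mul_cancel₀ _ ht0.ne']
    _ ≤ D ^ t * (Fintype.card ι : ℝ) ^ t * (Real.exp (2 + 2 * M / (ε / 16) ^ 2) ^ t *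
          Real.exp (-((1 - ε) * L)) ^ t) := by gcongr
    _ = _ := by rw [mul_pow, mul_pow, mul_pow]; ring

lemma stdGaussian_iUnion_dualVec_le {x : ι → E} {S : Finset ι} {N ε L : ℝ}
    (hN : 0 < N) (hε : 0 < ε) (hε1 : ε < 1) (hL : 0 < L) (hA : WellConditioned x S N) :
    (stdGaussian E).real (⋃ j ∈ S,
      {g | 2 * L * (1 - ε / 2) * (1 / N) < inner ℝ (dualVec x S j) g ^ 2}) ≤
    (ε / 2) ^ (-(1 / 2 : ℝ)) * (Fintype.card ι * Real.exp (-((1 - ε) * L))) := by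
  have hE : Real.exp (-((1 - ε / 2) / 2 * (2 * L * (1 - ε / 2)))) ≤ Real.exp (-((1 - ε) * L)) := by
    rw [Real.exp_le_exp]
    have : 0 ≤ ε ^ 2 * L := by positivity
    linarith
  refine (measureReal_biUnion_le_card_mul S fun j hj => (stdGaussian_sq_inner_tail
    (norm_dualVec_sq_le hN hA hj) (by linarith : 0 < ε / 2) (by linarith)
    (mul_pos (by linarith) (by linarith) : 0 < 2 * L * (1 - ε / 2))).trans
      (mul_le_mul_of_nonneg_left hE (by positivity))).trans ?_
  rw [mul_left_comm]
  gcongr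
  exact Finset.card_le_univ S

end union

/-! ### Stopping at the support -/

section stopping

/-- The rate of the tail bound for the relative decrease of the loss. The loss of `(1 - ε)` in the
exponent comes from the degrees of freedom `n - k - 1` and from the variance of the estimate of the
noise level; it is here that `1 / k ≤ ε ^ 2` is used. -/
lemma one_add_mul_rpow_le {ε L n k m : ℝ} (hε : 0 < ε) (hε1 : ε < 1) (hL : 0 ≤ L) (hn : 0 < n)
    (hk : 1 ≤ k) (hkL : 2 * k * L ≤ n) (hkε : 1 / k ≤ ε ^ 2) (hm0 : 0 ≤ m) (hm : n - (k + 1) ≤ m) :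
    (1 + (1 - ε / 2) * (2 * L / n)) ^ (-(m / 2)) ≤ Real.exp 1 * Real.exp (-((1 - ε) * L)) := by
  obtain ⟨a, ha⟩ : ∃ a, a = 2 * L / n := ⟨_, rfl⟩
  have ha0 : 0 ≤ a := by rw [ha]; positivity
  have han : a * n = 2 * L := by rw [ha]; field_simp
  have haε : a ≤ ε ^ 2 := by
    refine le_trans ?_ hkε
    rw [ha, div_le_div_iff₀ hn (by linarith)]
    linarith
  have ha1 : a ≤ 1 := haε.trans (pow_le_one₀ hε.le hε1.le)
  have hd0 : 0 ≤ 1 - ε / 2 := by linarith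
  rw [← ha]
  obtain ⟨y, hy⟩ : ∃ y, y = (1 - ε / 2) * a := ⟨_, rfl⟩
  have hy0 : 0 ≤ y := by rw [hy]; positivity
  have hya : y ≤ a := by
    rw [hy]; exact mul_le_of_le_one_left ha0 (by linarith)
  have hlog : y * (1 - a) ≤ Real.log (1 + y) := by
    have h1 := Real.one_sub_inv_le_log_of_pos (by linarith : 0 < 1 + y)
    refine le_trans ?_ h1
    have h2 : 1 - (1 + y)⁻¹ = y / (1 + y) := by field_simp; ring
    rw [h2, le_div_iff₀ (by linarith), mul_assoc]
    refine mul_le_of_le_one_right hy0 ?_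
    nlinarith
  rw [← hy, Real.rpow_def_of_pos (by linarith), ← Real.exp_add, Real.exp_le_exp]
  have hy1 : 0 ≤ y * (1 - a) := mul_nonneg hy0 (by linarith)
  have h1 : (n - (k + 1)) * (y * (1 - a)) ≤ m * Real.log (1 + y) :=
    (mul_le_mul_of_nonneg_right hm hy1).trans (mul_le_mul_of_nonneg_left hlog hm0)
  have h2 : a * (k + 1) ≤ 2 := by
    refine le_of_mul_le_mul_right ?_ hn
    have : L * 1 ≤ L * k := mul_le_mul_of_nonneg_left hk hL
    linarith [show a * (k + 1) * n = 2 * L * (k + 1) by rw [← han]; ring]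
  have h3 : (1 - ε / 2) * (1 - a) * (a * (k + 1)) ≤ 2 := by
    refine (mul_le_of_le_one_left (by positivity) ?_).trans h2
    exact mul_le_one₀ (by linarith) (by linarith) (by linarith)
  have h4 : (1 - ε) * (2 * L) ≤ (1 - ε / 2) * (1 - a) * (2 * L) := by
    refine mul_le_mul_of_nonneg_right ?_ (by linarith)
    refine le_trans ?_ (mul_le_mul_of_nonneg_left (sub_le_sub_left haε 1) hd0)
    have : 0 ≤ ε / 2 * (1 - ε) ^ 2 := by positivity
    linarith
  have h5 : (n - (k + 1)) * (y * (1 - a)) = (1 - ε / 2) * (1 - a) * (2 * L) -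
      (1 - ε / 2) * (1 - a) * (a * (k + 1)) := by
    rw [hy, ← han]; ring
  linarith

variable {n p : ℕ} {X : Matrix (Fin n) (Fin p) ℝ} {S : Finset (Fin p)} {β : Fin p → ℝ}

lemma residual_sum_add_smul (σ : ℝ) (g : EuclideanSpace ℝ (Fin n)) {A : Finset (Fin p)}
    (hSA : S ⊆ A) :
    residual X A (∑ i ∈ S, β i • column X i + σ • g) = σ • residual X A g := by
  refine residual_eq_of_sub_mem ?_
    (Submodule.smul_mem _ _ (Submodule.starProjection_apply_mem _ _))
  rw [add_sub_assoc, ← smul_sub]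
  exact Submodule.add_mem _ (Submodule.sum_mem _ fun i hi =>
    Submodule.smul_mem _ _ (column_mem_span (hSA hi)))
    (Submodule.smul_mem _ _ (sub_residual_mem g))

/-- The probability that a wrong variable decreases the loss of the support by the threshold. -/
lemma stdGaussian_le_loss_sub_le {σ ε L : ℝ} (hσ : 0 < σ) (hε : 0 < ε)
    (hε1 : ε < 1) (hL : 0 ≤ L) (hn : 0 < n) (hS : 1 ≤ S.card) (hSL : 2 * S.card * L ≤ n)
    (hSε : 1 / (S.card : ℝ) ≤ ε ^ 2) {j : Fin p}
    (hr : residual X S (column X j) ≠ 0) :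
    (stdGaussian (EuclideanSpace ℝ (Fin n))).real
      {g | 2 * L * loss X (∑ i ∈ S, β i • column X i + σ • g) S / n ≤
        loss X (∑ i ∈ S, β i • column X i + σ • g) S -
          loss X (∑ i ∈ S, β i • column X i + σ • g) (insert j S)} ≤
      (ε / 2) ^ (-(1 / 2 : ℝ)) * (Real.exp 1 * Real.exp (-((1 - ε) * L))) := by
  have hn' : (0 : ℝ) < n := by exact_mod_cast hn
  obtain ⟨u, hu⟩ : ∃ u, u = ‖residual X S (column X j)‖⁻¹ • residual X S (column X j) := ⟨_, rfl⟩
  obtain ⟨W, hW⟩ : ∃ W, W = Submodule.span ℝ (column X '' (insert j S : Finset (Fin p))) :=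
    ⟨_, rfl⟩
  have hu1 : ‖u‖ = 1 := by
    rw [hu, norm_smul, norm_inv, norm_norm, inv_mul_cancel₀ (norm_ne_zero_iff.2 hr)]
  have huS : u ∈ (Submodule.span ℝ (column X '' (S : Set (Fin p))))ᗮ := by
    rw [hu]; exact Submodule.smul_mem _ _ (Submodule.starProjection_apply_mem _ _)
  have huW : u ∈ Wᗮᗮ := by
    rw [Submodule.orthogonal_orthogonal, hW, hu]
    refine Submodule.smul_mem _ _ ?_
    have h1 := Submodule.sub_mem _ (column_mem_span (x := column X) (Finset.mem_insert_self j S))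
      (Submodule.span_mono (Set.image_mono (by simp))
        (sub_residual_mem (X := X) (S := S) (column X j)))
    rwa [sub_sub_cancel] at h1
  have hfin : (n : ℝ) - (S.card + 1) ≤ Module.finrank ℝ Wᗮ := by
    have h1 := W.finrank_add_finrank_orthogonal
    have h2 : Module.finrank ℝ W ≤ S.card + 1 := by
      have := finrank_span_finset_le_card (R := ℝ) ((insert j S).image (column X))
      rw [Finset.coe_image] at this
      rw [hW]
      exact (this.trans Finset.card_image_le).trans (Finset.card_insert_le _ _)
    rw [finrank_euclideanSpace_fin] at h1
    have : n ≤ S.card + 1 + Module.finrank ℝ Wᗮ := by omega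
    have : (n : ℝ) ≤ S.card + 1 + Module.finrank ℝ Wᗮ := by exact_mod_cast this
    linarith
  refine (measureReal_mono ?_).trans ((stdGaussian_ratio_tail hu1 huW
    (by positivity : 0 ≤ 2 * L / n) (by linarith : 0 < ε / 2) (by linarith)).trans
    (mul_le_mul_of_nonneg_left (one_add_mul_rpow_le hε hε1 hL hn' (by exact_mod_cast hS) hSL hSε
      (Nat.cast_nonneg _) hfin) (by positivity)))
  intro g hg
  simp only [Set.mem_ofPred_eq] at hg ⊢
  have h1 : loss X (∑ i ∈ S, β i • column X i + σ • g) (insert j S) =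
      σ ^ 2 * ‖Wᗮ.starProjection g‖ ^ 2 := by
    rw [loss, residual_sum_add_smul σ g (Finset.subset_insert _ _), norm_smul, mul_pow,
      Real.norm_eq_abs, sq_abs, hW, residual]
  have h2 : inner ℝ u (∑ i ∈ S, β i • column X i + σ • g) = σ * inner ℝ u g := by
    rw [inner_add_right, real_inner_smul_right, inner_sum, Finset.sum_eq_zero, zero_add]
    intro i hi
    rw [real_inner_smul_right, Submodule.inner_left_of_mem_orthogonal (column_mem_span hi) huS,
      mul_zero]
  rw [loss_eq_loss_insert_add hr, ← hu, h1, h2, add_sub_cancel_right] at hg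
  have hσ2 : 0 < σ ^ 2 := by positivity
  refine le_of_mul_le_mul_left (le_trans (le_of_eq ?_) (hg.trans_eq ?_)) hσ2 <;> ring

lemma stdGaussian_iUnion_le_loss_sub_le {σ ε L N : ℝ} (hN : 0 < N) (hσ : 0 < σ) (hε : 0 < ε)
    (hε1 : ε < 1) (hL : 0 ≤ L) (hn : 0 < n) (hS : 1 ≤ S.card) (hSL : 2 * S.card * L ≤ n)
    (hSε : 1 / (S.card : ℝ) ≤ ε ^ 2)
    (hA : ∀ F : Finset (Fin p), F.card ≤ S.card → WellConditioned (column X) (S ∪ F) N) :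
    (stdGaussian (EuclideanSpace ℝ (Fin n))).real (⋃ j ∈ Finset.univ.filter fun j => j ∉ S,
      {g | 2 * L * loss X (∑ i ∈ S, β i • column X i + σ • g) S / n ≤
        loss X (∑ i ∈ S, β i • column X i + σ • g) S -
          loss X (∑ i ∈ S, β i • column X i + σ • g) (insert j S)}) ≤
      (ε / 2) ^ (-(1 / 2 : ℝ)) * Real.exp 1 * (p * Real.exp (-((1 - ε) * L))) := by
  refine (measureReal_biUnion_le_card_mul _ fun j hj =>
    stdGaussian_le_loss_sub_le hσ hε hε1 hL hn hS hSL hSε ?_).trans ?_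
  · have hj' := (Finset.mem_filter.1 hj).2
    have h := starProjection_orthogonal_ne_zero hN (hA {j} (by simpa using hS)) (j := j) (by simp)
    rwa [Finset.union_comm, ← Finset.insert_eq, Finset.erase_insert hj'] at h
  · have h : ((Finset.univ.filter fun j => j ∉ S).card : ℝ) ≤ p := by
      exact_mod_cast (Finset.card_le_univ _).trans_eq (Fintype.card_fin p)
    refine (mul_le_mul_of_nonneg_right h (by positivity)).trans_eq ?_
    ring

end stopping

/-! ### Atypical noise -/

section atypical

variable {n p : ℕ} {X : Matrix (Fin n) (Fin p) ℝ} {S : Finset (Fin p)} {β : Fin p → ℝ}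

/-- The noise vectors (in units of the noise level `σ`) for which the argument fails: those that are
too long, those with a large component along a dual vector of the support, along the new directions
of a set of wrong variables, or along a signed sum of dual vectors, and those for which the search
goes on at the support. The conditions on sets of variables are imposed for all sizes `t` up to the
size of the support. The factor `1 - ε / 2` in the second condition leaves room
for the change of the dual vectors caused by the wrong variables. -/
def atypicalNoise (X : Matrix (Fin n) (Fin p) ℝ) (β : Fin p → ℝ) (S : Finset (Fin p))
    (σ ε L N : ℝ) (M : ℕ) : Set (EuclideanSpace ℝ (Fin n)) :=
  {g | √n + √(2 * L) ≤ ‖g‖} ∪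
  (⋃ j ∈ S, {g | 2 * L * (1 - ε / 2) * (1 / N) < inner ℝ (dualVec (column X) S j) g ^ 2}) ∪
  (⋃ t ∈ Finset.Icc 1 S.card, ⋃ F ∈ Finset.univ.filter fun F : Finset (Fin p) => F.card ≤ t,
    {g | 4 * t * L ≤ ‖(newDirections (column X) S F).starProjection g‖ ^ 2}) ∪
  (⋃ t ∈ Finset.Icc 1 S.card, ⋃ F ∈ Finset.univ.filter fun F : Finset (Fin p) => F.card ≤ t,
    ⋃ T ∈ Finset.univ.filter fun T : Finset (Fin p) => T ⊆ S ∧ T.card = t ∧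
      ((T \ grow (eligible (column X) S F N ((ε / 16) ^ 2) t) T M).card : ℝ) ≤ ε / 2 * t,
    {g | 2 * L * t * (t / N) < inner ℝ (signedDual (column X) (S ∪ F) β T) g ^ 2}) ∪
  (⋃ j ∈ Finset.univ.filter fun j => j ∉ S,
    {g | 2 * L * loss X (∑ i ∈ S, β i • column X i + σ • g) S / n ≤
      loss X (∑ i ∈ S, β i • column X i + σ • g) S -
        loss X (∑ i ∈ S, β i • column X i + σ • g) (insert j S)})

/-- A single failure probability `p^(-c)` is dominated by the ratio of the geometric series. -/
lemma exp_neg_le {ε L D G q : ℝ} (hε : 0 < ε) (hL : 0 ≤ L) (hD : 1 ≤ D) (hG : 1 ≤ G)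
    (hq : 1 ≤ q) : Real.exp (-L) ≤ D * G * (q * Real.exp (-((1 - ε) * L))) := by
  have h1 : Real.exp (-L) ≤ Real.exp (-((1 - ε) * L)) := by
    rw [Real.exp_le_exp]
    have : 0 ≤ ε * L := by positivity
    linarith
  rw [← mul_assoc]
  exact h1.trans (le_mul_of_one_le_left (Real.exp_nonneg _)
    (one_le_mul_of_one_le_of_one_le (one_le_mul_of_one_le_of_one_le hD hG) hq))

lemma stdGaussian_atypicalNoise_le {σ ε L N z : ℝ} {M : ℕ} (hN : 0 < N) (hσ : 0 < σ)
    (hε : 0 < ε) (hε1 : ε < 1) (hL : 0 < L) (hn : 0 < n) (hS : 1 ≤ S.card)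
    (hSL : 2 * S.card * L ≤ n) (hSε : 1 / (S.card : ℝ) ≤ ε ^ 2) (hpL : (p : ℝ) ≤ Real.exp L)
    (hA : ∀ F : Finset (Fin p), F.card ≤ S.card → WellConditioned (column X) (S ∪ F) N)
    (hz : z = (ε / 2) ^ (-(1 / 2 : ℝ)) * Real.exp (2 + 2 * M / (ε / 16) ^ 2) *
      (p * Real.exp (-((1 - ε) * L)))) (hz2 : z ≤ 1 / 2) :
    (stdGaussian (EuclideanSpace ℝ (Fin n))).real (atypicalNoise X β S σ ε L N M) ≤ 7 * z := by
  have hSp : S.card ≤ p := (Finset.card_le_univ S).trans_eq (Fintype.card_fin p)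
  have hp : (1 : ℝ) ≤ p := by exact_mod_cast hS.trans hSp
  have hD : 1 ≤ (ε / 2) ^ (-(1 / 2 : ℝ)) := one_le_rpow_neg_half (by linarith) (by linarith)
  have hG : Real.exp 1 ≤ Real.exp (2 + 2 * M / (ε / 16) ^ 2) := by
    rw [Real.exp_le_exp]
    have : 0 ≤ 2 * M / (ε / 16) ^ 2 := by positivity
    linarith
  have hG1 : 1 ≤ Real.exp (2 + 2 * M / (ε / 16) ^ 2) := (Real.one_le_exp zero_le_one).trans hG
  have hz0 : 0 ≤ z := by rw [hz]; positivity
  have hez : (ε / 2) ^ (-(1 / 2 : ℝ)) * Real.exp 1 * (p * Real.exp (-((1 - ε) * L))) ≤ z := by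
    rw [hz]; gcongr
  have hcard : Fintype.card (Fin p) = p := Fintype.card_fin p
  have h1 := (stdGaussian_norm_tail hn hL.le).trans (exp_neg_le hε hL.le hD hG1 hp)
  rw [← hz] at h1
  have h2 : _ ≤ z := (stdGaussian_iUnion_dualVec_le hN hε hε1 hL
    ((hA ∅ (by simp)).mono Finset.subset_union_left)).trans <| by
      rw [hcard, hz]
      exact mul_le_mul_of_nonneg_right (le_mul_of_one_le_right (by linarith) hG1) (by positivity)
  have h3 : _ ≤ 2 * z := (measureReal_biUnion_finset_le (Finset.Icc 1 S.card) _).trans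
    ((Finset.sum_le_sum fun t ht => (stdGaussian_iUnion_newDirections_le (column X) S hε hε1 hL.le
      (Finset.mem_Icc.1 ht).1 (((Finset.mem_Icc.1 ht).2.trans hSp).trans_eq hcard.symm)).trans
      (pow_le_pow_left₀ (by positivity) (by rw [hcard]; exact hez) t)).trans
      (sum_pow_le_two_mul hz0 hz2 S.card))
  have h4 : _ ≤ 2 * z := (measureReal_biUnion_finset_le (Finset.Icc 1 S.card) _).trans
    ((Finset.sum_le_sum fun t ht => (stdGaussian_iUnion_signedDual_le (x := column X) (S := S)
      (β := β) hN hε hε1 hL (by rwa [hcard])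
      (Finset.mem_Icc.1 ht).1 (((Finset.mem_Icc.1 ht).2.trans hSp).trans_eq hcard.symm)
      (fun F hF => hA F (hF.trans (Finset.mem_Icc.1 ht).2)) M).trans_eq
      (by rw [hcard, ← hz])).trans (sum_pow_le_two_mul hz0 hz2 S.card))
  have h5 := (stdGaussian_iUnion_le_loss_sub_le (β := β) hN hσ hε hε1 hL.le hn hS hSL hSε hA).trans
    hez
  rw [atypicalNoise]
  refine (measureReal_union_le _ _).trans ?_
  refine (add_le_add ((measureReal_union_le _ _).trans (add_le_add ((measureReal_union_le _ _).trans
    (add_le_add ((measureReal_union_le _ _).trans (add_le_add h1 h2)) h3)) h4)) h5).trans ?_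
  linarith

/-- If the noise is typical, then the search stops at the support and not earlier. -/
lemma path_eq_some_of_notMem_atypicalNoise {alg : Algorithm n p} {c ε L σ b N : ℝ} {M : ℕ}
    {g : EuclideanSpace ℝ (Fin n)}
    (hε : 0 < ε) (hε1 : ε < 1) (hL : 0 < L) (hcL : L = c * Real.log p) (hσ : 0 < σ) (hb : 0 < b)
    (hN : 0 < N) (hn : 0 < n) (hM : 2 / ε ≤ (1 + (ε / 16) ^ 2) ^ M)
    (hcol : ∀ j, ‖column X j‖ ^ 2 = n)
    (hA : ∀ F : Finset (Fin p), F.card ≤ S.card → WellConditioned (column X) (S ∪ F) N)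
    (hβ : ∀ j ∈ S, b ≤ |β j|)
    (hΞ : ∀ Q : ℝ, Q ≤ S.card * (2 * L * Q) / N + (σ * (√n + √(2 * L))) ^ 2 →
      √(2 * L * Q) / N ≤ b / 2)
    (hbN : 8 * σ ^ 2 * L < b ^ 2 * N) (hSn : S.card ≤ n) (hSp : S.card < p)
    (hg : g ∉ atypicalNoise X β S σ ε L N M)
    (hS : alg.run (∑ i ∈ S, β i • column X i + σ • g) X S.card = S) :
    path alg (∑ i ∈ S, β i • column X i + σ • g) X c = some S := by
  have hthr : ∀ S', 2 * c * sigmaHatSq X (∑ i ∈ S, β i • column X i + σ • g) S' * Real.log p =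
      2 * L * loss X (∑ i ∈ S, β i • column X i + σ • g) S' / n := by
    intro S'; rw [sigmaHatSq, hcL]; ring
  simp only [atypicalNoise, Set.mem_union, Set.mem_iUnion, Set.mem_ofPred_eq, not_or, not_exists,
    not_le, not_lt, Finset.mem_filter, Finset.mem_univ, true_and] at hg
  obtain ⟨⟨⟨⟨hgR, hgM⟩, hgV⟩, hgU⟩, hgS⟩ := hg
  refine path_eq_some (le_min hSn hSp.le) hS ?_ fun S' hS' => ?_
  · rw [hthr]
    refine maxDecrease_lt ?_ hgS
    by_contra! h
    have := Finset.card_le_card (fun j _ => h j : (Finset.univ : Finset (Fin p)) ⊆ S)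
    rw [Finset.card_univ, Fintype.card_fin] at this
    omega
  · obtain ⟨j, hj, hj'⟩ := exists_le_loss_sub_of_card_lt hε hε1 hL hσ hb hN hn hM hcol hA hβ hΞ
      hbN hgR hgM hgV (fun t ht F hF T hTS hTt h => hgU t ht F hF T ⟨hTS, hTt, h⟩) hS'
    rw [hthr, not_lt]
    exact hj'.trans (sub_loss_insert_le_maxDecrease _ hj)

/-- The conclusion with an explicit constant, for `ε > 0`; for large values of the bound on the
failure probability it is trivial, otherwise the geometric series over the set sizes
bounds it. -/
lemma le_real_path_eq_some {ε c : ℝ} {M n p k : ℕ} {X : Matrix (Fin n) (Fin p) ℝ} {β : Fin p → ℝ}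
    {σ : ℝ≥0} {alg : Algorithm n p} {Ω : Type*} {_ : MeasurableSpace Ω} {P : Measure Ω}
    [IsProbabilityMeasure P] {w : Fin n → Ω → ℝ} (hε : ε < 1) (hε0 : 0 < ε) (hc1 : 1 < c)
    (hM : 2 / ε ≤ (1 + (ε / 16) ^ 2) ^ M)
    (hk1 : 1 ≤ k) (hkp : 2 * k ≤ p) (hσ : 0 < σ) (hcol : ∀ j, ‖column X j‖ ^ 2 / n = 1)
    (hw : iIndepFun w P) (hlaw : ∀ i, HasLaw (w i) (gaussianReal 0 (σ ^ 2)) P)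
    (hk : (supp β).card = k)
    (halg : 1 - 1 / (p : ℝ) ^ c ≤
      P.real {ω | alg.run (observe X β (fun i => w i ω)) X k = supp β})
    (hρ : 0 < restrictedEigenvalue X (supp β) (2 * k)) (hkε : (k : ℝ) / n + √(1 / (k : ℝ)) < ε)
    (hsize : 2 * c * k * Real.log p / restrictedEigenvalue X (supp β) (2 * k) +
        8 * σ * c * √(k : ℝ) * Real.log p /
          (betaMin β * restrictedEigenvalue X (supp β) (2 * k) ^ 2) +
        8 * (σ : ℝ) ^ 2 * c * Real.log p /
          (betaMin β ^ 2 * restrictedEigenvalue X (supp β) (2 * k) ^ 2) ≤ n) :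
    1 - 8 * ((ε / 2) ^ (-(1 / 2 : ℝ)) * Real.exp (2 + 2 * M / (ε / 16) ^ 2)) *
        (p : ℝ) ^ (1 - (1 - ε) * c) ≤
      P.real {ω | path alg (observe X β (fun i => w i ω)) X c = some (supp β)} := by
  have hp2 : 2 ≤ p := by omega
  have hp0 : (0 : ℝ) < p := by exact_mod_cast (by omega : 0 < p)
  have hp1 : (1 : ℝ) < p := by exact_mod_cast (by omega : 1 < p)
  have hk1' : (1 : ℝ) ≤ k := by exact_mod_cast hk1
  have hσ' : (0 : ℝ) < σ := by exact_mod_cast hσ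
  obtain ⟨L, hcL⟩ : ∃ L, L = c * Real.log p := ⟨_, rfl⟩
  have hlog : 0 < Real.log p := Real.log_pos hp1
  have hL : 0 < L := by rw [hcL]; positivity
  have hpL : (p : ℝ) ≤ Real.exp L := by
    rw [← Real.log_le_iff_le_exp hp0, hcL]
    exact le_mul_of_one_le_left hlog.le hc1.le
  obtain ⟨z, hz⟩ : ∃ z, z = (ε / 2) ^ (-(1 / 2 : ℝ)) * Real.exp (2 + 2 * M / (ε / 16) ^ 2) *
      (p * Real.exp (-((1 - ε) * L))) := ⟨_, rfl⟩
  have hrate : (p : ℝ) ^ (1 - (1 - ε) * c) = p * Real.exp (-((1 - ε) * L)) := by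
    rw [Real.rpow_def_of_pos hp0, hcL]
    nth_rw 2 [← Real.exp_log hp0]
    rw [← Real.exp_add]
    congr 1; ring
  rw [hrate, mul_assoc, ← hz]
  rcases lt_or_ge (1 / 2) z with hz2 | hz2
  · have : 0 ≤ P.real {ω | path alg (observe X β (fun i => w i ω)) X c = some (supp β)} :=
      measureReal_nonneg
    linarith
  obtain ⟨S, hS⟩ : ∃ S, S = supp β := ⟨_, rfl⟩
  obtain ⟨ρ, hρ'⟩ : ∃ ρ, ρ = restrictedEigenvalue X S (2 * k) := ⟨_, rfl⟩
  obtain ⟨b, hb'⟩ : ∃ b, b = betaMin β := ⟨_, rfl⟩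
  have hSne : S.Nonempty := Finset.card_pos.1 (by rw [hS]; omega)
  have hb : 0 < b := by rw [hb']; exact betaMin_pos (hS ▸ hSne)
  have hβ : ∀ j ∈ S, b ≤ |β j| := by
    intro j hj; rw [hb']; exact betaMin_le (hS ▸ hj)
  have hobs : ∀ ω, observe X β (fun i => w i ω) =
      ∑ i ∈ S, β i • column X i + (σ : ℝ) • WithLp.toLp 2 fun i => w i ω / σ := by
    intro ω
    rw [observe_eq, ← hS, ← WithLp.toLp_smul]
    congr 2
    ext i
    simp only [Pi.smul_apply, smul_eq_mul]
    field_simp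
  rw [← hS] at hk halg ⊢
  rw [← hS, ← hρ'] at hρ hsize
  rw [← hb'] at hsize
  simp only [hobs] at halg ⊢
  have hn : 0 < n := by
    refine Nat.pos_of_ne_zero fun h => ?_
    have := hcol ⟨0, by omega⟩
    rw [show (n : ℝ) = 0 by exact_mod_cast h, div_zero] at this
    exact zero_ne_one this
  have hn' : (0 : ℝ) < n := by exact_mod_cast hn
  have hcol' : ∀ j, ‖column X j‖ ^ 2 = n := fun j => (div_eq_one_iff_eq hn'.ne').1 (hcol j)
  have hA : ∀ F : Finset (Fin p), F.card ≤ S.card →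
      WellConditioned (column X) (S ∪ F) (n * ρ) := by
    intro F hF
    rw [hρ']
    refine wellConditioned_column hn hkp Finset.subset_union_left ?_
    have := Finset.card_union_le S F
    omega
  have hρ1 : ρ ≤ 1 := by
    obtain ⟨j, hj⟩ := hSne
    have := (hA ∅ (by simp)).le_norm_sq (Finset.mem_union_left _ hj)
    rw [hcol'] at this
    exact le_of_mul_le_mul_left (by linarith) hn'
  have hsize' : 2 * k * L / ρ + 8 * σ * √k * L / (b * ρ ^ 2) +
      8 * (σ : ℝ) ^ 2 * L / (b ^ 2 * ρ ^ 2) ≤ n := by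
    refine le_trans (le_of_eq ?_) hsize
    rw [hcL]; ring
  have hN : 0 < n * ρ := by positivity
  have hkn : (k : ℝ) / n < 1 := by
    have := Real.sqrt_nonneg (1 / (k : ℝ))
    linarith
  have hkn' : k ≤ n := by
    rw [div_lt_one hn'] at hkn
    exact_mod_cast hkn.le
  have hkε' : 1 / (k : ℝ) ≤ ε ^ 2 := by
    have : 0 ≤ (k : ℝ) / n := by positivity
    exact (Real.sqrt_le_iff.1 (by linarith : √(1 / (k : ℝ)) ≤ ε)).2
  have hkL : 2 * k * L ≤ n := by
    have := two_mul_mul_le_of_size hL.le hσ'.le hb hρ hsize'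
    exact this.trans (mul_le_of_le_one_right hn'.le hρ1)
  have hatyp : (stdGaussian (EuclideanSpace ℝ (Fin n))).real
      (atypicalNoise X β S σ ε L (n * ρ) M) ≤ 7 * z :=
    stdGaussian_atypicalNoise_le hN hσ' hε0 hε hL hn (by omega) (by rwa [hk]) (by rwa [hk]) hpL hA
      hz hz2
  obtain ⟨hmeas, hmap⟩ := map_noise_eq_stdGaussian hσ hw hlaw
  have hpre : P.real ((fun ω => (WithLp.toLp 2 fun i => w i ω / σ : EuclideanSpace ℝ (Fin n))) ⁻¹'
      atypicalNoise X β S σ ε L (n * ρ) M) ≤ 7 * z := by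
    refine le_trans ?_ hatyp
    rw [← hmap]
    have : IsProbabilityMeasure (P.map fun ω =>
        (WithLp.toLp 2 fun i => w i ω / σ : EuclideanSpace ℝ (Fin n))) :=
      Measure.isProbabilityMeasure_map hmeas
    exact ENNReal.toReal_mono (measure_ne_top _ _) (Measure.le_map_apply hmeas _)
  have hfail : 1 / (p : ℝ) ^ c ≤ z := by
    rw [Real.rpow_def_of_pos hp0, mul_comm, ← hcL, one_div, ← Real.exp_neg, hz]
    refine exp_neg_le hε0 hL.le (one_le_rpow_neg_half (by linarith) (by linarith)) ?_ hp1.le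
    exact Real.one_le_exp (by positivity)
  -- the events need not be measurable, so only subadditivity is used
  have hcover : {ω | alg.run (∑ i ∈ S, β i • column X i +
        (σ : ℝ) • WithLp.toLp 2 fun i => w i ω / σ) X k = S} ⊆
      {ω | path alg (∑ i ∈ S, β i • column X i + (σ : ℝ) • WithLp.toLp 2 fun i => w i ω / σ) X c
        = some S} ∪
      (fun ω => (WithLp.toLp 2 fun i => w i ω / σ : EuclideanSpace ℝ (Fin n))) ⁻¹'
        atypicalNoise X β S σ ε L (n * ρ) M := by
    intro ω hω
    by_cases hg : (WithLp.toLp 2 fun i => w i ω / σ : EuclideanSpace ℝ (Fin n)) ∈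
      atypicalNoise X β S σ ε L (n * ρ) M
    · exact Or.inr hg
    refine Or.inl (path_eq_some_of_notMem_atypicalNoise hε0 hε hL hcL hσ' hb hN hn hM hcol' hA
      hβ (fun Q hQ => ?_) (sq_mul_lt_of_size (by linarith) hL hσ'.le hb hρ hρ1 hsize')
      (hk.trans_le hkn') (by omega) hg ?_)
    · exact sqrt_two_mul_loss_div_le hk1' hL hσ' hb hρ hρ1 hn' hsize' (by rwa [hk] at hQ)
    · rw [hk]; exact hω
  linarith [halg.trans ((measureReal_mono hcover).trans (measureReal_union_le _ _))]

end atypical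

end SparseRegression

theorem theorem1 (ε c : ℝ) (hε : ε < 1) (hc : 1 / (1 - ε) < c) :
    ∃ C : ℝ, 0 < C ∧
      ∀ (n p k : ℕ) (X : Matrix (Fin n) (Fin p) ℝ) (β : Fin p → ℝ) (σ : ℝ≥0)
        (alg : SparseRegression.Algorithm n p)
        (Ω : Type*) (_ : MeasurableSpace Ω) (P : Measure Ω) (_ : IsProbabilityMeasure P)
        (w : Fin n → Ω → ℝ),
        1 ≤ k → 2 * k ≤ p → 0 < σ →
        -- normalized columns
        (∀ j, ‖SparseRegression.column X j‖ ^ 2 / n = 1) →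
        -- i.i.d. Gaussian noise
        iIndepFun w P → (∀ i, HasLaw (w i) (gaussianReal 0 (σ ^ 2)) P) →
        -- `β` has exactly `k` non-zero entries
        (SparseRegression.supp β).card = k →
        -- the algorithm finds the true support at the true sparsity level
        1 - 1 / (p : ℝ) ^ c ≤
          P.real {ω | alg.run (SparseRegression.observe X β (fun i => w i ω)) X k
            = SparseRegression.supp β} →
        0 < SparseRegression.restrictedEigenvalue X (SparseRegression.supp β) (2 * k) →
        (k : ℝ) / n + √(1 / (k : ℝ)) < ε →
        2 * c * k * Real.log p
              / SparseRegression.restrictedEigenvalue X (SparseRegression.supp β) (2 * k)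
            + 8 * σ * c * √(k : ℝ) * Real.log p
              / (SparseRegression.betaMin β
                * SparseRegression.restrictedEigenvalue X (SparseRegression.supp β) (2 * k) ^ 2)
            + 8 * (σ : ℝ) ^ 2 * c * Real.log p
              / (SparseRegression.betaMin β ^ 2
                * SparseRegression.restrictedEigenvalue X (SparseRegression.supp β) (2 * k) ^ 2)
          ≤ (n : ℝ) →
        1 - C * (p : ℝ) ^ (1 - (1 - ε) * c) ≤
          P.real {ω | SparseRegression.path alg
              (SparseRegression.observe X β (fun i => w i ω)) X c
            = some (SparseRegression.supp β)} := by
  rcases le_or_gt ε 0 with hε0 | hε0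
  · -- the condition `k / n + √(1 / k) < ε` cannot hold
    refine ⟨1, one_pos, ?_⟩
    intro n p k X β σ alg Ω _ P _ w _ _ _ _ _ _ _ _ _ hkε _
    have : 0 ≤ (k : ℝ) / n + √(1 / (k : ℝ)) := by positivity
    linarith
  have hc1 : 1 < c := by
    refine lt_of_le_of_lt ?_ hc
    rw [le_div_iff₀ (by linarith)]; linarith
  obtain ⟨M, hM⟩ := pow_unbounded_of_one_lt (2 / ε)
    (by have : 0 < (ε / 16) ^ 2 := by positivity
        linarith : 1 < 1 + (ε / 16) ^ 2)
  refine ⟨8 * ((ε / 2) ^ (-(1 / 2 : ℝ)) * Real.exp (2 + 2 * M / (ε / 16) ^ 2)), by positivity, ?_⟩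
  intro n p k X β σ alg Ω _ P _ w hk1 hkp hσ hcol hw hlaw hk halg hρ hkε hsize
  exact SparseRegression.le_real_path_eq_some hε hε0 hc1 hM.le hk1 hkp hσ hcol hw hlaw hk halg hρ
    hkε hsize
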